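/- **Theorem 1.2 (Weak asymptotics for Pareto potentials).** Let $d\ge 1$ be an integer, let $\alpha>d$ be real, and let $\{\xi(z):z\in\mathbb Z^d\}$ be independent, identically distributed real random variables with distribution function $$F(x)=P(\xi(0)\le x)=1-x^{-\alpha}\qquad\text{for all }x\ge 1 .$$ Consider the parabolic Anderson problem $$\partial_t u(t,z)=\sum_{y\in\mathbb Z^d,\ |y-z|_1=1}\bigl[u(t,y)-u(t,z)\bigr]+\xi(z)\,u(t,z),\quad (t,z)\in(0,\infty)\times\mathbb Z^d,\qquad u(0,z)=\mathbf 1_{\{z=0\}},\quad z\in\mathbb Z^d,$$ where a solution is a function on $[0,\infty)\times\mathbb Z^d$ such that, for each $z\in\mathbb Z^d$, $t\mapsto u(t,z)$ is continuous on $[0,\infty)$ and differentiable on $(0,\infty)$. Then, almost surely, this problem has exactly one nonnegative solution $u$, and its total mass $U(t):=\sum_{z\in\mathbb Z^d}u(t,z)$ is finite for all $t\ge 0$. Moreover, with $L_t:=\frac1t\log U(t)$, as $t\uparrow\infty$ through the reals, $$L_t\left(\frac{t}{\log t}\right)^{-d/(\alpha-d)}\ \Longrightarrow\ Y\qquad\text{in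 law},$$ where $Y$ is a random variable with $P(Y\le y)=\exp\{-\theta\,y^{d-\alpha}\}$ for $y>0$ and $P(Y\le y)=0$ for $y\le 0$, and $$\theta=\frac{(\alpha-d)^d\,2^d\,B(\alpha-d,d)}{d^d\,(d-1)!},$$ with $B$ the beta function. -/

import Mathlib

open Filter Topology MeasureTheory ProbabilityTheory Set
open scoped NNReal

namespace ParabolicAnderson

/-- The discrete Laplacian on `ℤ^d`: the sum of `f y - f z` over the `2 d` nearest neighbours
`y = z ± e_i` of `z`. -/
noncomputable def discreteLaplacian {d : ℕ} (f : (Fin d → ℤ) → ℝ) (z : Fin d → ℤ) : ℝ :=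
  ∑ i : Fin d, ((f (z + Pi.single i 1) - f z) + (f (z - Pi.single i 1) - f z))

/-- `u : [0, ∞) × ℤ^d → ℝ` is a nonnegative solution of the parabolic Anderson problem with
potential `ξ` and localized initial condition: `∂ₜ u = Δ u + ξ u` on `(0, ∞) × ℤ^d`, and
`u(0, ·)` is the indicator function of the origin, attained continuously. Values of `u` at negative
times play no role. -/
structure IsNonnegSolution {d : ℕ} (ξ : (Fin d → ℤ) → ℝ) (u : ℝ → (Fin d → ℤ) → ℝ) : Prop where
  nonneg : ∀ t, 0 ≤ t → ∀ z, 0 ≤ u t z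
  initial : ∀ z, u 0 z = if z = 0 then 1 else 0
  continuousOn : ∀ z, ContinuousOn (fun t => u t z) (Ici 0)
  hasDerivAt : ∀ t, 0 < t → ∀ z,
    HasDerivAt (fun s => u s z) (discreteLaplacian (u t) z + ξ z * u t z) t

/-- The total mass `U(t) = ∑_z u(t, z)`. -/
noncomputable def totalMass {d : ℕ} (u : ℝ → (Fin d → ℤ) → ℝ) (t : ℝ) : ℝ :=
  ∑' z : Fin d → ℤ, u t z

/-- `L_t = (1 / t) log U(t)`. -/
noncomputable def logMass {d : ℕ} (u : ℝ → (Fin d → ℤ) → ℝ) (t : ℝ) : ℝ :=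
  1 / t * Real.log (totalMass u t)

/-- The constant `θ = (α - d)^d 2^d B(α - d, d) / (d^d (d - 1)!)`, used for `d ≥ 1` and `α > d`. -/
noncomputable def frechetConst (d : ℕ) (α : ℝ) : ℝ :=
  (α - d) ^ d * 2 ^ d * ProbabilityTheory.beta (α - d) d
    / ((d : ℝ) ^ d * (Nat.factorial (d - 1) : ℝ))

end ParabolicAnderson

/-! Summing over random walk paths by their number of jumps (`jumpTerm`) gives the minimal solution.
If `ξ z ≤ A + c|z|`, the weight `exp (c (T - t)|z|)` decays in time just fast enough to absorb the
growth (`sum_jumpTerm_le`). This yields existence and `U(t) ≤ exp ((A - 2d) t + 2d e^{ct} t)`. The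
path sum lies below every nonnegative solution, so uniqueness reduces to nonnegative evolutions
started from zero. Positivity bounds these at distance `n` by about `n!/T^n` for any `T`, since the
mass there would otherwise be too large on reaching the origin. Iterating Duhamel's formula `n`
times gains `1/n!`, and a large `T` finishes (`IsNonnegEvolution.eq_zero`). For `α > d`,
Borel–Cantelli gives linear growth with `c = 1`.

For the law, put `a = massScale` and `r = spaceScale`, so that `a t / r = log t` and `a^{-α} r^d =
1`. The event `L_t ≤ a y` is nearly the event that `ξ` lies below the cone `a (y + q|z|/r)` with
critical slope `q = d/(α - d)`. Below a cone with smaller `q`, the mass bound has `e^{ct} = t^q =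
o(a)`, whence `L_t ≲ a y` (`eventually_logMass_div_le`). Conversely, walking quickly to `z` and
staying there costs about `|z| log (|z|/t)`, so a small `L_t` forces `ξ` below a cone of slightly
larger slope in a growing box (`eventually_le_of_logMass_div_le`).

By independence, a cone event has a product probability. Its logarithm is a Riemann sum whose limit
combines the volume of the cross-polytope with a beta integral: the limiting probability is `exp (-θ
(d/(α - d)/q)^d y^{d - α})`. Squeezing height and slope from both sides gives the Fréchet law. -/

namespace ParabolicAnderson

variable {d : ℕ}

/-! ### Lattice geometry and neighbour sums -/

/-- The `ℓ¹`-norm on `ℤ^d`. -/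
def l1Norm (z : Fin d → ℤ) : ℕ := ∑ i, (z i).natAbs

lemma l1Norm_eq_zero {z : Fin d → ℤ} : l1Norm z = 0 ↔ z = 0 := by
  simp [l1Norm, funext_iff]

lemma l1Norm_add_le (y z : Fin d → ℤ) : l1Norm (y + z) ≤ l1Norm y + l1Norm z := by
  unfold l1Norm
  rw [← Finset.sum_add_distrib]
  exact Finset.sum_le_sum fun i _ => Int.natAbs_add_le _ _

lemma l1Norm_single (i : Fin d) (a : ℤ) : l1Norm (Pi.single i a) = a.natAbs := by
  unfold l1Norm
  rw [Finset.sum_eq_single i]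
  · simp
  · intro j _ hj; simp [hj]
  · simp

lemma l1Norm_neg (z : Fin d → ℤ) : l1Norm (-z) = l1Norm z := by simp [l1Norm]

lemma l1Norm_sub_le (y z : Fin d → ℤ) : l1Norm (y - z) ≤ l1Norm y + l1Norm z := by
  rw [sub_eq_add_neg, ← l1Norm_neg z]; exact l1Norm_add_le _ _

lemma l1Norm_add_single_le (z : Fin d → ℤ) (i : Fin d) :
    l1Norm (z + Pi.single i 1) ≤ l1Norm z + 1 := by
  simpa [l1Norm_single] using l1Norm_add_le z (Pi.single i 1)

lemma l1Norm_sub_single_le (z : Fin d → ℤ) (i : Fin d) :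
    l1Norm (z - Pi.single i 1) ≤ l1Norm z + 1 := by
  simpa [l1Norm_single] using l1Norm_sub_le z (Pi.single i 1)

/-- Every site other than the origin has a neighbour which is closer to the origin. -/
lemma exists_neighbor_l1Norm {z : Fin d → ℤ} {n : ℕ} (hz : l1Norm z = n + 1) :
    ∃ i, l1Norm (z + Pi.single i 1) = n ∨ l1Norm (z - Pi.single i 1) = n := by
  obtain ⟨i, hi⟩ : ∃ i, z i ≠ 0 := by
    by_contra! h
    rw [l1Norm_eq_zero.2 (funext h)] at hz
    omega
  have key : ∀ w : Fin d → ℤ, (∀ j, j ≠ i → w j = z j) →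
      l1Norm w + (z i).natAbs = l1Norm z + (w i).natAbs := by
    intro w hw
    unfold l1Norm
    rw [← Finset.add_sum_erase _ _ (Finset.mem_univ i),
      ← Finset.add_sum_erase _ (fun j => (z j).natAbs) (Finset.mem_univ i),
      Finset.sum_congr rfl fun j hj => by rw [hw j (Finset.ne_of_mem_erase hj)]]
    ring
  refine ⟨i, ?_⟩
  rcases lt_or_gt_of_ne hi with h | h
  · left
    have := key (z + Pi.single i 1) fun j hj => by simp [hj]
    simp only [Pi.add_apply, Pi.single_eq_same] at this
    omega
  · right
    have := key (z - Pi.single i 1) fun j hj => by simp [hj]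
    simp only [Pi.sub_apply, Pi.single_eq_same] at this
    omega

/-- The sum of a function over the nearest neighbours of a site. -/
noncomputable def neighborSum (f : (Fin d → ℤ) → ℝ) (z : Fin d → ℤ) : ℝ :=
  ∑ i : Fin d, (f (z + Pi.single i 1) + f (z - Pi.single i 1))

lemma discreteLaplacian_eq (f : (Fin d → ℤ) → ℝ) (z : Fin d → ℤ) :
    discreteLaplacian f z = neighborSum f z - 2 * d * f z := by
  simp only [discreteLaplacian, neighborSum, Finset.sum_add_distrib, Finset.sum_sub_distrib,
    Finset.sum_const, Finset.card_univ, Fintype.card_fin, nsmul_eq_mul]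
  ring

lemma neighborSum_nonneg {f : (Fin d → ℤ) → ℝ} (hf : ∀ z, 0 ≤ f z) (z : Fin d → ℤ) :
    0 ≤ neighborSum f z :=
  Finset.sum_nonneg fun _ _ => add_nonneg (hf _) (hf _)

lemma neighborSum_mono {f g : (Fin d → ℤ) → ℝ} (h : ∀ z, f z ≤ g z) (z : Fin d → ℤ) :
    neighborSum f z ≤ neighborSum g z :=
  Finset.sum_le_sum fun _ _ => add_le_add (h _) (h _)

lemma neighborSum_le {f : (Fin d → ℤ) → ℝ} {z : Fin d → ℤ} {M : ℝ}
    (h : ∀ y, l1Norm y ≤ l1Norm z + 1 → f y ≤ M) : neighborSum f z ≤ 2 * d * M := by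
  calc neighborSum f z ≤ ∑ _i : Fin d, (M + M) :=
        Finset.sum_le_sum fun i _ =>
          add_le_add (h _ (l1Norm_add_single_le z i)) (h _ (l1Norm_sub_single_le z i))
    _ = 2 * d * M := by simp; ring

lemma neighborSum_sub (f g : (Fin d → ℤ) → ℝ) (z : Fin d → ℤ) :
    neighborSum (fun y => f y - g y) z = neighborSum f z - neighborSum g z := by
  simp only [neighborSum, ← Finset.sum_sub_distrib]
  exact Finset.sum_congr rfl fun _ _ => by ring

lemma neighborSum_finsetSum {ι : Type*} (s : Finset ι) (f : ι → (Fin d → ℤ) → ℝ) (z : Fin d → ℤ) :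
    neighborSum (fun y => ∑ k ∈ s, f k y) z = ∑ k ∈ s, neighborSum (f k) z := by
  simp_rw [neighborSum, ← Finset.sum_add_distrib]
  exact Finset.sum_comm

lemma hasSum_neighborSum {f : ℕ → (Fin d → ℤ) → ℝ} {g : (Fin d → ℤ) → ℝ}
    (h : ∀ y, HasSum (fun k => f k y) (g y)) (z : Fin d → ℤ) :
    HasSum (fun k => neighborSum (f k) z) (neighborSum g z) :=
  hasSum_sum fun _ _ => (h _).add (h _)

lemma le_neighborSum_of_l1Norm {f : (Fin d → ℤ) → ℝ} (hf : ∀ z, 0 ≤ f z) (z : Fin d → ℤ)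
    (i : Fin d) : f (z + Pi.single i 1) + f (z - Pi.single i 1) ≤ neighborSum f z :=
  Finset.single_le_sum (f := fun i => f (z + Pi.single i 1) + f (z - Pi.single i 1))
    (fun _ _ => add_nonneg (hf _) (hf _)) (Finset.mem_univ i)

/-! ### Differential inequalities -/

/-- Comparison of functions through their derivatives. -/
lemma le_of_hasDerivAt_le {f g f' g' : ℝ → ℝ} {a b : ℝ} (hab : a ≤ b)
    (hf : ContinuousOn f (Icc a b)) (hg : ContinuousOn g (Icc a b))
    (hf' : ∀ x ∈ Ioo a b, HasDerivAt f (f' x) x) (hg' : ∀ x ∈ Ioo a b, HasDerivAt g (g' x) x)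
    (ha : f a ≤ g a) (hle : ∀ x ∈ Ioo a b, f' x ≤ g' x) : f b ≤ g b := by
  have hmono : MonotoneOn (fun x => g x - f x) (Icc a b) := by
    refine monotoneOn_of_deriv_nonneg (convex_Icc a b) (hg.sub hf) ?_ ?_
    · intro x hx
      rw [interior_Icc] at hx
      exact ((hg' x hx).fun_sub (hf' x hx)).differentiableAt.differentiableWithinAt
    · intro x hx
      rw [interior_Icc] at hx
      rw [((hg' x hx).fun_sub (hf' x hx)).deriv]
      linarith [hle x hx]
  have := hmono (left_mem_Icc.2 hab) (right_mem_Icc.2 hab) hab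
  simp only at this
  linarith

/-- Grönwall-type positivity: `f' ≥ κ f` and `f a ≥ 0` imply `f b ≥ exp (κ (b - a)) * f a`. -/
lemma exp_mul_le_of_hasDerivAt {f f' : ℝ → ℝ} {a b κ : ℝ} (hab : a ≤ b)
    (hf : ContinuousOn f (Icc a b)) (hf' : ∀ x ∈ Ioo a b, HasDerivAt f (f' x) x)
    (hle : ∀ x ∈ Ioo a b, κ * f x ≤ f' x) : Real.exp (κ * (b - a)) * f a ≤ f b := by
  have h := le_of_hasDerivAt_le (f := fun _ => Real.exp (-κ * a) * f a)
    (g := fun x => Real.exp (-κ * x) * f x) (f' := fun _ => 0)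
    (g' := fun x => Real.exp (-κ * x) * (f' x - κ * f x)) hab continuousOn_const
    (ContinuousOn.mul (by fun_prop) hf) (fun x _ => hasDerivAt_const x _) ?_ le_rfl ?_
  · have h2 := mul_le_mul_of_nonneg_left h (Real.exp_pos (κ * b)).le
    rw [← mul_assoc, ← mul_assoc, ← Real.exp_add, ← Real.exp_add] at h2
    rwa [show κ * b + -κ * a = κ * (b - a) by ring, show κ * b + -κ * b = 0 by ring,
      Real.exp_zero, one_mul] at h2
  · intro x hx
    have h1 : HasDerivAt (fun x => Real.exp (-κ * x)) (Real.exp (-κ * x) * (-κ * 1)) x :=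
      ((hasDerivAt_id x).const_mul (-κ)).exp
    exact (h1.fun_mul (hf' x hx)).congr_deriv (by ring)
  · intro x hx
    exact mul_nonneg (Real.exp_pos _).le (sub_nonneg.2 (hle x hx))

/-! ### Path expansion: existence, minimality and mass bound -/

/-- The contribution to the solution of the parabolic Anderson problem made by the random walk
paths with exactly `k` jumps. -/
noncomputable def jumpTerm (ξ : (Fin d → ℤ) → ℝ) : ℕ → ℝ → (Fin d → ℤ) → ℝ
  | 0, t, z => if z = 0 then Real.exp ((ξ z - 2 * d) * t) else 0
  | k + 1, t, z => Real.exp ((ξ z - 2 * d) * t) *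
      ∫ s in (0 : ℝ)..t, Real.exp (-((ξ z - 2 * d) * s)) * neighborSum (jumpTerm ξ k s) z

/-- Continuity is joint in the potential (product topology) and time. The dependence on the
potential later makes the total mass measurable in `ω`. -/
lemma continuous_jumpTerm (k : ℕ) (z : Fin d → ℤ) :
    Continuous fun p : ((Fin d → ℤ) → ℝ) × ℝ => jumpTerm p.1 k p.2 z := by
  induction k generalizing z with
  | zero =>
    simp only [jumpTerm]
    split_ifs
    · fun_prop
    · exact continuous_const
  | succ k ih =>
    simp only [jumpTerm]
    refine Continuous.mul (by fun_prop) ?_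
    refine intervalIntegral.continuous_parametric_intervalIntegral_of_continuous
      (f := fun (p : ((Fin d → ℤ) → ℝ) × ℝ) (s : ℝ) =>
        Real.exp (-((p.1 z - 2 * d) * s)) * neighborSum (jumpTerm p.1 k s) z) ?_ continuous_snd
    have hp : ∀ y, Continuous fun x : (((Fin d → ℤ) → ℝ) × ℝ) × ℝ => jumpTerm x.1.1 k x.2 y :=
      fun y => (ih y).comp (f := fun x : (((Fin d → ℤ) → ℝ) × ℝ) × ℝ => (x.1.1, x.2)) (by fun_prop)
    simp only [Function.uncurry_def, neighborSum]
    fun_prop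

lemma continuous_jumpTerm_time (ξ : (Fin d → ℤ) → ℝ) (k : ℕ) (z : Fin d → ℤ) :
    Continuous fun t => jumpTerm ξ k t z :=
  (continuous_jumpTerm k z).comp (f := fun t : ℝ => (ξ, t)) (by fun_prop)

lemma continuous_neighborSum {f : ℝ → (Fin d → ℤ) → ℝ} (hf : ∀ z, Continuous fun t => f t z)
    (z : Fin d → ℤ) : Continuous fun t => neighborSum (f t) z := by
  unfold neighborSum
  fun_prop

lemma jumpTerm_nonneg (ξ : (Fin d → ℤ) → ℝ) (k : ℕ) {t : ℝ} (ht : 0 ≤ t) (z : Fin d → ℤ) :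
    0 ≤ jumpTerm ξ k t z := by
  induction k generalizing t z with
  | zero => simp only [jumpTerm]; split_ifs <;> positivity
  | succ k ih =>
    refine mul_nonneg (Real.exp_pos _).le (intervalIntegral.integral_nonneg ht fun s hs => ?_)
    exact mul_nonneg (Real.exp_pos _).le (neighborSum_nonneg (ih hs.1) z)

lemma jumpTerm_at_zero (ξ : (Fin d → ℤ) → ℝ) (k : ℕ) (z : Fin d → ℤ) :
    jumpTerm ξ k 0 z = if k = 0 ∧ z = 0 then 1 else 0 := by
  cases k <;> simp [jumpTerm]

lemma hasDerivAt_jumpTerm_zero (ξ : (Fin d → ℤ) → ℝ) (t : ℝ) (z : Fin d → ℤ) :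
    HasDerivAt (fun s => jumpTerm ξ 0 s z) ((ξ z - 2 * d) * jumpTerm ξ 0 t z) t := by
  simp only [jumpTerm]
  split_ifs
  · exact ((hasDerivAt_id' t).const_mul (ξ z - 2 * (d : ℝ))).exp.congr_deriv (by ring)
  · simpa using hasDerivAt_const t (0 : ℝ)

lemma hasDerivAt_jumpTerm_succ (ξ : (Fin d → ℤ) → ℝ) (k : ℕ) (t : ℝ) (z : Fin d → ℤ) :
    HasDerivAt (fun s => jumpTerm ξ (k + 1) s z)
      ((ξ z - 2 * d) * jumpTerm ξ (k + 1) t z + neighborSum (jumpTerm ξ k t) z) t := by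
  have hc : Continuous fun s => Real.exp (-((ξ z - 2 * d) * s)) * neighborSum (jumpTerm ξ k s) z :=
    Continuous.mul (by fun_prop) (continuous_neighborSum (continuous_jumpTerm_time ξ k) z)
  have h1 := intervalIntegral.integral_hasDerivAt_right (hc.intervalIntegrable 0 t)
    (hc.stronglyMeasurableAtFilter _ _) hc.continuousAt
  have h2 : HasDerivAt (fun s => Real.exp ((ξ z - 2 * d) * s))
      (Real.exp ((ξ z - 2 * d) * t) * ((ξ z - 2 * d) * 1)) t :=
    ((hasDerivAt_id t).const_mul (ξ z - 2 * (d : ℝ))).exp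
  refine (h2.fun_mul h1).congr_deriv ?_
  rw [← mul_assoc (Real.exp _) (Real.exp _), ← Real.exp_add, add_neg_cancel, Real.exp_zero,
    jumpTerm]
  ring

/-- The weighted mass which is obtained from the walks with `k` jumps, for a potential of at most
linear growth. -/
lemma sum_jumpTerm_le {ξ : (Fin d → ℤ) → ℝ} {A c : ℝ} (hc : 0 ≤ c)
    (hξ : ∀ z, ξ z ≤ A + c * l1Norm z) {T : ℝ} (k : ℕ) (F : Finset (Fin d → ℤ)) {t : ℝ}
    (ht : 0 ≤ t) (htT : t ≤ T) :
    ∑ z ∈ F, jumpTerm ξ k t z * Real.exp (c * (T - t) * l1Norm z) ≤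
      Real.exp ((A - 2 * d) * t) * ((2 * d * Real.exp (c * T) * t) ^ k / k.factorial) := by
  induction k generalizing F t with
  | zero =>
    simp only [jumpTerm, pow_zero, Nat.factorial_zero, Nat.cast_one, div_one, mul_one, ite_mul,
      zero_mul]
    rw [Finset.sum_ite_eq' F]
    split_ifs
    · have h0 : l1Norm (0 : Fin d → ℤ) = 0 := l1Norm_eq_zero.2 rfl
      have := hξ 0
      rw [h0] at this ⊢
      simp only [CharP.cast_eq_zero, mul_zero, add_zero, Real.exp_zero, mul_one] at this ⊢
      gcongr
    · positivity
  | succ k ih =>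
    have hshift : ∀ s, 0 ≤ s → s ≤ T →
        ∑ z ∈ F, neighborSum (jumpTerm ξ k s) z * Real.exp (c * (T - s) * l1Norm z) ≤
        2 * d * Real.exp (c * T) * (Real.exp ((A - 2 * d) * s) *
          ((2 * d * Real.exp (c * T) * s) ^ k / k.factorial)) := by
      intro s hs hsT
      set R := Real.exp ((A - 2 * d) * s) * ((2 * d * Real.exp (c * T) * s) ^ k / k.factorial)
      have hone : ∀ e : Fin d → ℤ, l1Norm e = 1 →
          ∑ z ∈ F, jumpTerm ξ k s (z + e) * Real.exp (c * (T - s) * l1Norm z) ≤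
            Real.exp (c * T) * R := by
        intro e he
        calc ∑ z ∈ F, jumpTerm ξ k s (z + e) * Real.exp (c * (T - s) * l1Norm z)
            ≤ ∑ z ∈ F, Real.exp (c * T) *
                (jumpTerm ξ k s (z + e) * Real.exp (c * (T - s) * l1Norm (z + e))) := by
              refine Finset.sum_le_sum fun z _ => ?_
              rw [mul_left_comm, ← Real.exp_add]
              refine mul_le_mul_of_nonneg_left (Real.exp_le_exp.2 ?_) (jumpTerm_nonneg ξ k hs _)
              -- One jump changes the weight by a factor of at most `exp (c (T - s)) ≤ exp (c T)`.
              have h1 : (l1Norm z : ℝ) ≤ l1Norm (z + e) + 1 := by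
                have := l1Norm_sub_le (z + e) e
                rw [add_sub_cancel_right, he] at this
                exact_mod_cast this
              have h2 : c * (T - s) * l1Norm z ≤ c * (T - s) * (l1Norm (z + e) + 1) :=
                mul_le_mul_of_nonneg_left h1 (mul_nonneg hc (by linarith))
              nlinarith [mul_nonneg hc hs]
          _ = Real.exp (c * T) * ∑ z ∈ F.map (addRightEmbedding e),
                jumpTerm ξ k s z * Real.exp (c * (T - s) * l1Norm z) := by
              rw [Finset.sum_map, Finset.mul_sum]; rfl
          _ ≤ _ := mul_le_mul_of_nonneg_left (ih _ hs hsT) (Real.exp_pos _).le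
      calc ∑ z ∈ F, neighborSum (jumpTerm ξ k s) z * Real.exp (c * (T - s) * l1Norm z)
          = ∑ i : Fin d,
            (∑ z ∈ F, jumpTerm ξ k s (z + Pi.single i 1) * Real.exp (c * (T - s) * l1Norm z) +
             ∑ z ∈ F, jumpTerm ξ k s (z + -Pi.single i 1) * Real.exp (c * (T - s) * l1Norm z)) := by
            simp_rw [neighborSum, Finset.sum_mul, ← Finset.sum_add_distrib, add_mul,
              ← sub_eq_add_neg]
            exact Finset.sum_comm
        _ ≤ ∑ _i : Fin d, (Real.exp (c * T) * R + Real.exp (c * T) * R) :=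
            Finset.sum_le_sum fun i _ => add_le_add (hone _ (by simp [l1Norm_single]))
              (hone _ (by simp [l1Norm_neg, l1Norm_single]))
        _ = _ := by simp; ring
    -- The time derivative of the weight contributes `-c|z|`. After multiplication by `exp (-(A -
    -- 2d) s)`, the coefficient of the `k + 1` term is `ξ z - A - c|z| ≤ 0`, so only the inflow from
    -- walks with `k` jumps remains.
    have hkey := le_of_hasDerivAt_le (a := 0) (b := t)
      (f := fun s => Real.exp (-((A - 2 * d) * s)) *
        ∑ z ∈ F, jumpTerm ξ (k + 1) s z * Real.exp (c * (T - s) * l1Norm z))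
      (g := fun s => (2 * d * Real.exp (c * T) * s) ^ (k + 1) / (k + 1).factorial)
      (f' := fun s => Real.exp (-((A - 2 * d) * s)) *
        ∑ z ∈ F, ((ξ z - A - c * l1Norm z) * jumpTerm ξ (k + 1) s z
          + neighborSum (jumpTerm ξ k s) z) * Real.exp (c * (T - s) * l1Norm z))
      (g' := fun s => 2 * d * Real.exp (c * T) *
        ((2 * d * Real.exp (c * T) * s) ^ k / k.factorial)) ht ?_ (by fun_prop) ?_ ?_ ?_ ?_
    · rw [Real.exp_neg, ← div_eq_inv_mul, div_le_iff₀' (Real.exp_pos _)] at hkey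
      exact hkey
    · have := continuous_jumpTerm_time ξ (k + 1)
      fun_prop
    · intro s _
      have h1 : HasDerivAt (fun s => Real.exp (-((A - 2 * d) * s)))
          (Real.exp (-((A - 2 * d) * s)) * (-((A - 2 * d) * 1))) s :=
        ((hasDerivAt_id s).const_mul (A - 2 * (d : ℝ))).neg.exp
      have h2 : ∀ z : Fin d → ℤ, HasDerivAt (fun s => Real.exp (c * (T - s) * l1Norm z))
          (Real.exp (c * (T - s) * l1Norm z) * (c * (-1) * l1Norm z)) s := fun z =>
        ((((hasDerivAt_id s).const_sub T).const_mul c).mul_const (l1Norm z : ℝ)).exp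
      refine (h1.fun_mul (HasDerivAt.fun_sum (u := F) fun z _ =>
        (hasDerivAt_jumpTerm_succ ξ k s z).fun_mul (h2 z))).congr_deriv ?_
      rw [mul_assoc, ← mul_add, Finset.mul_sum, ← Finset.sum_add_distrib]
      congr 1
      refine Finset.sum_congr rfl fun z _ => ?_
      ring
    · intro s _
      have h1 : HasDerivAt (fun s => (2 * d * Real.exp (c * T) * s) ^ (k + 1)) _ s :=
        ((hasDerivAt_id' s).const_mul (2 * d * Real.exp (c * T))).fun_pow (k + 1)
      refine (h1.div_const ((k + 1).factorial : ℝ)).congr_deriv ?_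
      have : ((k + 1).factorial : ℝ) = (k + 1) * k.factorial := by
        rw [Nat.factorial_succ]; push_cast; ring
      rw [this]
      have hk : (k.factorial : ℝ) ≠ 0 := by positivity
      simp only [Nat.add_sub_cancel]
      push_cast
      field_simp
    · simp [jumpTerm_at_zero]
    · intro s hs
      have hs0 := hs.1.le
      have hsT : s ≤ T := hs.2.le.trans htT
      calc _ ≤ Real.exp (-((A - 2 * d) * s)) *
            ∑ z ∈ F, neighborSum (jumpTerm ξ k s) z * Real.exp (c * (T - s) * l1Norm z) := by
            refine mul_le_mul_of_nonneg_left (Finset.sum_le_sum fun z _ => ?_) (Real.exp_pos _).le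
            refine mul_le_mul_of_nonneg_right ?_ (Real.exp_pos _).le
            have := mul_nonneg (sub_nonneg.2 (hξ z)) (jumpTerm_nonneg ξ (k + 1) hs0 z)
            nlinarith
        _ ≤ _ := by
            refine (mul_le_mul_of_nonneg_left (hshift s hs0 hsT) (Real.exp_pos _).le).trans_eq ?_
            rw [mul_left_comm, ← mul_assoc (Real.exp _) (Real.exp _), ← Real.exp_add,
              neg_add_cancel, Real.exp_zero, one_mul]

/-- Uniformity in `t ≤ T` and in the site is what the Weierstrass test needs, both for the series
and for its term-by-term derivative. -/
lemma jumpTerm_le {ξ : (Fin d → ℤ) → ℝ} {A c : ℝ} (hc : 0 ≤ c)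
    (hξ : ∀ z, ξ z ≤ A + c * l1Norm z) {T t : ℝ} (ht : 0 ≤ t) (htT : t ≤ T) (k : ℕ)
    (z : Fin d → ℤ) :
    jumpTerm ξ k t z ≤
      Real.exp (|A - 2 * d| * T) * ((2 * d * Real.exp (c * T) * T) ^ k / k.factorial) := by
  have h := sum_jumpTerm_le hc hξ k {z} ht htT
  rw [Finset.sum_singleton] at h
  have h1 : 1 ≤ Real.exp (c * (T - t) * l1Norm z) :=
    Real.one_le_exp (mul_nonneg (mul_nonneg hc (by linarith)) (Nat.cast_nonneg _))
  refine (le_mul_of_one_le_right (jumpTerm_nonneg ξ k ht z) h1).trans (h.trans ?_)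
  have h2 : (A - 2 * d) * t ≤ |A - 2 * d| * T :=
    (mul_le_mul_of_nonneg_right (le_abs_self _) ht).trans
      (mul_le_mul_of_nonneg_left htT (abs_nonneg _))
  gcongr

lemma summable_jumpTerm {ξ : (Fin d → ℤ) → ℝ} {A c : ℝ} (hc : 0 ≤ c)
    (hξ : ∀ z, ξ z ≤ A + c * l1Norm z) {t : ℝ} (ht : 0 ≤ t) (z : Fin d → ℤ) :
    Summable fun k => jumpTerm ξ k t z :=
  Summable.of_nonneg_of_le (fun k => jumpTerm_nonneg ξ k ht z)
    (fun k => jumpTerm_le hc hξ ht le_rfl k z)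
    ((Real.summable_pow_div_factorial _).mul_left _)

/-- The sum over all walks: the minimal nonnegative solution of the parabolic Anderson problem. -/
noncomputable def minimalSolution (ξ : (Fin d → ℤ) → ℝ) (t : ℝ) (z : Fin d → ℤ) : ℝ :=
  ∑' k, jumpTerm ξ k t z

/-- The derivative in time of `jumpTerm`. -/
noncomputable def jumpTermDeriv (ξ : (Fin d → ℤ) → ℝ) (k : ℕ) (t : ℝ) (z : Fin d → ℤ) : ℝ :=
  (ξ z - 2 * d) * jumpTerm ξ k t z + k.casesOn 0 fun j => neighborSum (jumpTerm ξ j t) z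

lemma hasDerivAt_jumpTerm (ξ : (Fin d → ℤ) → ℝ) (k : ℕ) (t : ℝ) (z : Fin d → ℤ) :
    HasDerivAt (fun s => jumpTerm ξ k s z) (jumpTermDeriv ξ k t z) t := by
  cases k with
  | zero => simpa [jumpTermDeriv] using hasDerivAt_jumpTerm_zero ξ t z
  | succ k => exact hasDerivAt_jumpTerm_succ ξ k t z

lemma hasSum_jumpTermDeriv {ξ : (Fin d → ℤ) → ℝ} {A c : ℝ} (hc : 0 ≤ c)
    (hξ : ∀ z, ξ z ≤ A + c * l1Norm z) {t : ℝ} (ht : 0 ≤ t) (z : Fin d → ℤ) :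
    HasSum (fun k => jumpTermDeriv ξ k t z)
      ((ξ z - 2 * d) * minimalSolution ξ t z + neighborSum (minimalSolution ξ t) z) := by
  have hs := fun y => (summable_jumpTerm hc hξ ht y).hasSum
  refine ((hs z).mul_left _).add ?_
  have h : HasSum (fun k => neighborSum (jumpTerm ξ k t) z) (neighborSum (minimalSolution ξ t) z) :=
    hasSum_neighborSum hs z
  rw [← hasSum_nat_add_iff' 1]
  simpa using h

lemma hasDerivAt_minimalSolution {ξ : (Fin d → ℤ) → ℝ} {A c : ℝ} (hc : 0 ≤ c)
    (hξ : ∀ z, ξ z ≤ A + c * l1Norm z) {t : ℝ} (ht : 0 < t) (z : Fin d → ℤ) :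
    HasDerivAt (fun s => minimalSolution ξ s z)
      ((ξ z - 2 * d) * minimalSolution ξ t z + neighborSum (minimalSolution ξ t) z) t := by
  rw [← (hasSum_jumpTermDeriv hc hξ ht.le z).tsum_eq]
  set B : ℕ → ℝ := fun k => Real.exp (|A - 2 * d| * (t + 1)) *
    ((2 * d * Real.exp (c * (t + 1)) * (t + 1)) ^ k / k.factorial)
  have hBs : Summable B := (Real.summable_pow_div_factorial _).mul_left _
  have hBle : ∀ s ∈ Ioo 0 (t + 1), ∀ k y, jumpTerm ξ k s y ≤ B k := fun s hs k y =>
    jumpTerm_le hc hξ hs.1.le hs.2.le k y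
  -- This majorizes the derivatives: the inflow into level `k` comes from level `k - 1`, hence the
  -- index shift.
  have hu : Summable fun k => |ξ z - 2 * d| * B k + k.casesOn 0 fun j => 2 * d * B j := by
    refine (hBs.mul_left _).add ?_
    rw [← summable_nat_add_iff 1]
    exact hBs.mul_left _
  have htmem : t ∈ Ioo 0 (t + 1) := ⟨ht, by linarith⟩
  refine hasDerivAt_tsum_of_isPreconnected hu isOpen_Ioo isPreconnected_Ioo
    (fun k s _ => hasDerivAt_jumpTerm ξ k s z) ?_ htmem (summable_jumpTerm hc hξ ht.le z) htmem
  intro k s hs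
  refine (norm_add_le _ _).trans (add_le_add ?_ ?_)
  · rw [norm_mul, Real.norm_eq_abs, Real.norm_of_nonneg (jumpTerm_nonneg ξ k hs.1.le z)]
    exact mul_le_mul_of_nonneg_left (hBle s hs k z) (abs_nonneg _)
  · cases k with
    | zero => simp
    | succ k =>
      simp only
      rw [Real.norm_of_nonneg (neighborSum_nonneg (jumpTerm_nonneg ξ k hs.1.le) z)]
      exact neighborSum_le fun y _ => hBle s hs k y

lemma isNonnegSolution_minimalSolution {ξ : (Fin d → ℤ) → ℝ} {A c : ℝ} (hc : 0 ≤ c)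
    (hξ : ∀ z, ξ z ≤ A + c * l1Norm z) : IsNonnegSolution ξ (minimalSolution ξ) where
  nonneg t ht z := tsum_nonneg fun k => jumpTerm_nonneg ξ k ht z
  initial z := by
    simp only [minimalSolution, jumpTerm_at_zero]
    rw [tsum_eq_single 0 fun k hk => by simp [hk]]
    simp
  continuousOn z t ht := by
    have h : ContinuousOn (fun s => minimalSolution ξ s z) (Icc 0 (t + 1)) :=
      continuousOn_tsum (fun k => (continuous_jumpTerm_time ξ k z).continuousOn)
        ((Real.summable_pow_div_factorial _).mul_left _) fun k s hs => by
          rw [Real.norm_of_nonneg (jumpTerm_nonneg ξ k hs.1 z)]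
          exact jumpTerm_le hc hξ hs.1 hs.2 k z
    refine (h t ⟨ht, by linarith⟩).mono_of_mem_nhdsWithin ?_
    rw [← Ici_inter_Iic]
    exact inter_mem_nhdsWithin _ (Iic_mem_nhds (by linarith))
  hasDerivAt t ht z := by
    rw [discreteLaplacian_eq]
    exact (hasDerivAt_minimalSolution hc hξ ht z).congr_deriv (by ring)

lemma IsNonnegSolution.hasDerivAt_neighborSum {ξ : (Fin d → ℤ) → ℝ} {u : ℝ → (Fin d → ℤ) → ℝ}
    (hu : IsNonnegSolution ξ u) {t : ℝ} (ht : 0 < t) (z : Fin d → ℤ) :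
    HasDerivAt (fun s => u s z) ((ξ z - 2 * d) * u t z + neighborSum (u t) z) t :=
  (hu.hasDerivAt t ht z).congr_deriv (by rw [discreteLaplacian_eq]; ring)

/-- Subtracting the walks with at most `n` jumps from `u` leaves a function that vanishes at time
zero. Its source is the neighbour sum of `u` minus the walks with fewer than `n` jumps, which is
nonnegative by induction, so Grönwall applies. -/
lemma sum_jumpTerm_le_of_isNonnegSolution {ξ : (Fin d → ℤ) → ℝ} {u : ℝ → (Fin d → ℤ) → ℝ}
    (hu : IsNonnegSolution ξ u) (n : ℕ) {t : ℝ} (ht : 0 ≤ t) (z : Fin d → ℤ) :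
    ∑ k ∈ Finset.range n, jumpTerm ξ k t z ≤ u t z := by
  induction n generalizing t z with
  | zero => simpa using hu.nonneg t ht z
  | succ n ih =>
    have h := exp_mul_le_of_hasDerivAt (κ := ξ z - 2 * d) (a := 0) (b := t)
      (f := fun s => u s z - ∑ k ∈ Finset.range (n + 1), jumpTerm ξ k s z) ht ?_
      (fun s hs => (hu.hasDerivAt_neighborSum hs.1 z).fun_sub
        (HasDerivAt.fun_sum fun k _ => hasDerivAt_jumpTerm ξ k s z)) ?_
    · have h0 : ∑ k ∈ Finset.range (n + 1), jumpTerm ξ k 0 z = u 0 z := by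
        rw [hu.initial, Finset.sum_range_succ']
        simp [jumpTerm_at_zero]
      rw [h0, sub_self, mul_zero] at h
      linarith
    · refine ((hu.continuousOn z).mono Icc_subset_Ici_self).sub ?_
      exact (continuous_finsetSum _ fun k _ => continuous_jumpTerm_time ξ k z).continuousOn
    · intro s hs
      have h1 : ∑ k ∈ Finset.range (n + 1), jumpTermDeriv ξ k s z =
          (ξ z - 2 * d) * ∑ k ∈ Finset.range (n + 1), jumpTerm ξ k s z +
            ∑ k ∈ Finset.range n, neighborSum (jumpTerm ξ k s) z := by
        simp only [jumpTermDeriv]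
        rw [Finset.sum_add_distrib, Finset.mul_sum, add_right_inj, Finset.sum_range_succ']
        simp
      have h2 := neighborSum_mono (fun y => ih hs.1.le y) z
      rw [neighborSum_finsetSum] at h2
      rw [h1]
      linarith

lemma minimalSolution_le {ξ : (Fin d → ℤ) → ℝ} {u : ℝ → (Fin d → ℤ) → ℝ}
    (hu : IsNonnegSolution ξ u) {t : ℝ} (ht : 0 ≤ t) (z : Fin d → ℤ) :
    minimalSolution ξ t z ≤ u t z :=
  Real.tsum_le_of_sum_range_le (fun k => jumpTerm_nonneg ξ k ht z)
    fun n => sum_jumpTerm_le_of_isNonnegSolution hu n ht z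

/-- Summing the weighted bounds over all numbers of jumps at `T = t`, where the weight is one,
produces the exponential series. -/
lemma sum_minimalSolution_le {ξ : (Fin d → ℤ) → ℝ} {A c : ℝ} (hc : 0 ≤ c)
    (hξ : ∀ z, ξ z ≤ A + c * l1Norm z) {t : ℝ} (ht : 0 ≤ t) (F : Finset (Fin d → ℤ)) :
    ∑ z ∈ F, minimalSolution ξ t z ≤
      Real.exp ((A - 2 * d) * t + 2 * d * Real.exp (c * t) * t) := by
  have hs := hasSum_sum (s := F) fun z _ => (summable_jumpTerm hc hξ ht z).hasSum
  have hexp : HasSum (fun k : ℕ => Real.exp ((A - 2 * d) * t) *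
      ((2 * d * Real.exp (c * t) * t) ^ k / k.factorial))
      (Real.exp ((A - 2 * d) * t) * Real.exp (2 * d * Real.exp (c * t) * t)) := by
    refine HasSum.mul_left _ ?_
    rw [Real.exp_eq_exp_ℝ]
    exact NormedSpace.expSeries_div_hasSum_exp (𝔸 := ℝ) _
  rw [Real.exp_add]
  refine hasSum_le (fun k => ?_) hs hexp
  have h := sum_jumpTerm_le hc hξ k F ht le_rfl
  simpa using h

lemma summable_minimalSolution {ξ : (Fin d → ℤ) → ℝ} {A c : ℝ} (hc : 0 ≤ c)
    (hξ : ∀ z, ξ z ≤ A + c * l1Norm z) {t : ℝ} (ht : 0 ≤ t) :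
    Summable (minimalSolution ξ t) :=
  summable_of_sum_le (fun z => tsum_nonneg fun k => jumpTerm_nonneg ξ k ht z)
    fun F => sum_minimalSolution_le hc hξ ht F

lemma totalMass_minimalSolution_le {ξ : (Fin d → ℤ) → ℝ} {A c : ℝ} (hc : 0 ≤ c)
    (hξ : ∀ z, ξ z ≤ A + c * l1Norm z) {t : ℝ} (ht : 0 ≤ t) :
    totalMass (minimalSolution ξ) t ≤
      Real.exp ((A - 2 * d) * t + 2 * d * Real.exp (c * t) * t) :=
  (summable_minimalSolution hc hξ ht).tsum_le_of_sum_le fun F => sum_minimalSolution_le hc hξ ht F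

/-! ### Nonnegative evolutions and uniqueness -/

/-- Nonnegative solutions of `∂ₜ w = Δ w + ξ w`, without a condition on the initial value. -/
structure IsNonnegEvolution (ξ : (Fin d → ℤ) → ℝ) (w : ℝ → (Fin d → ℤ) → ℝ) : Prop where
  nonneg : ∀ t, 0 ≤ t → ∀ z, 0 ≤ w t z
  continuousOn : ∀ z, ContinuousOn (fun t => w t z) (Ici 0)
  hasDerivAt : ∀ t, 0 < t → ∀ z,
    HasDerivAt (fun s => w s z) ((ξ z - 2 * d) * w t z + neighborSum (w t) z) t

lemma IsNonnegSolution.isNonnegEvolution {ξ : (Fin d → ℤ) → ℝ} {u : ℝ → (Fin d → ℤ) → ℝ}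
    (hu : IsNonnegSolution ξ u) : IsNonnegEvolution ξ u :=
  ⟨hu.nonneg, hu.continuousOn, fun _ ht z => hu.hasDerivAt_neighborSum ht z⟩

namespace IsNonnegEvolution

variable {ξ : (Fin d → ℤ) → ℝ} {w : ℝ → (Fin d → ℤ) → ℝ}

/-- The mass at a site grows at least like `exp ((ξ z - 2 d) t)`. -/
lemma exp_mul_le (hw : IsNonnegEvolution ξ w) {s t : ℝ} (hs : 0 ≤ s) (hst : s ≤ t)
    (z : Fin d → ℤ) : Real.exp ((ξ z - 2 * d) * (t - s)) * w s z ≤ w t z := by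
  refine exp_mul_le_of_hasDerivAt hst ((hw.continuousOn z).mono fun r hr => hs.trans hr.1)
    (fun r hr => hw.hasDerivAt r (hs.trans_lt hr.1) z) fun r hr => ?_
  exact le_add_of_nonneg_right (neighborSum_nonneg (hw.nonneg r (hs.trans hr.1.le)) z)

/-- A lower bound for the mass transported along a shortest path. -/
lemma pow_div_factorial_mul_le (hw : IsNonnegEvolution ξ w) (hξ : ∀ z, 0 ≤ ξ z) (n : ℕ)
    {s t : ℝ} (hs : 0 ≤ s) (hst : s ≤ t) {y z : Fin d → ℤ} (hn : l1Norm (z - y) = n) :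
    (t - s) ^ n / n.factorial * w s y ≤ Real.exp (2 * d * (t - s)) * w t z := by
  induction n generalizing t z with
  | zero =>
    obtain rfl : z = y := sub_eq_zero.1 (l1Norm_eq_zero.1 hn)
    have h := hw.exp_mul_le hs hst z
    have h1 := mul_le_mul_of_nonneg_left h (Real.exp_pos (2 * d * (t - s))).le
    rw [← mul_assoc, ← Real.exp_add] at h1
    refine le_trans ?_ h1
    simp only [pow_zero, Nat.factorial_zero, Nat.cast_one, div_one]
    refine mul_le_mul_of_nonneg_right (Real.one_le_exp ?_) (hw.nonneg s hs z)
    have := mul_nonneg (hξ z) (sub_nonneg.2 hst)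
    linarith
  | succ n ih =>
    -- The neighbour `z'` is one step closer to `y`; its mass feeds `z`, and the factor `exp (2 d (r
    -- - s))` cancels the loss term.
    obtain ⟨z', hz', hle⟩ : ∃ z', l1Norm (z' - y) = n ∧ ∀ r, 0 ≤ r →
        w r z' ≤ neighborSum (w r) z := by
      obtain ⟨i, hi | hi⟩ := exists_neighbor_l1Norm hn
      · refine ⟨z + Pi.single i 1, by rwa [add_sub_right_comm], fun r hr => ?_⟩
        linarith [le_neighborSum_of_l1Norm (hw.nonneg r hr) z i,
          hw.nonneg r hr (z - Pi.single i 1)]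
      · refine ⟨z - Pi.single i 1, by rwa [sub_right_comm], fun r hr => ?_⟩
        linarith [le_neighborSum_of_l1Norm (hw.nonneg r hr) z i,
          hw.nonneg r hr (z + Pi.single i 1)]
    refine le_of_hasDerivAt_le (f := fun r => (r - s) ^ (n + 1) / (n + 1).factorial * w s y)
      (g := fun r => Real.exp (2 * d * (r - s)) * w r z)
      (f' := fun r => (r - s) ^ n / n.factorial * w s y)
      (g' := fun r => Real.exp (2 * d * (r - s)) * (ξ z * w r z + neighborSum (w r) z))
      hst (by fun_prop) ?_ ?_ ?_ ?_ ?_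
    · exact ContinuousOn.mul (by fun_prop) ((hw.continuousOn z).mono fun r hr => hs.trans hr.1)
    · intro r _
      have h1 := (((((hasDerivAt_id' r).sub_const s).fun_pow (n + 1)).div_const
        ((n + 1).factorial : ℝ)).mul_const (w s y))
      refine h1.congr_deriv ?_
      have : ((n + 1).factorial : ℝ) = (n + 1) * n.factorial := by
        rw [Nat.factorial_succ]; push_cast; ring
      rw [this]
      have hk : (n.factorial : ℝ) ≠ 0 := by positivity
      simp only [Nat.add_sub_cancel]
      push_cast
      field_simp
    · intro r hr
      have h1 := (((hasDerivAt_id' r).sub_const s).const_mul (2 * (d : ℝ))).exp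
      exact (h1.fun_mul (hw.hasDerivAt r (hs.trans_lt hr.1) z)).congr_deriv (by ring)
    · simpa using hw.nonneg s hs z
    · intro r hr
      have hr0 := hs.trans hr.1.le
      refine (ih hr.1.le hz').trans (mul_le_mul_of_nonneg_left ?_ (Real.exp_pos _).le)
      linarith [hle r hr0, mul_nonneg (hξ z) (hw.nonneg r hr0 z)]

/-- The bound from iterating Duhamel's formula `n` times, for an evolution started from zero. -/
lemma le_pow_div_factorial (hw : IsNonnegEvolution ξ w) (h0 : ∀ z, w 0 z = 0) {N : ℕ}
    {K M δ : ℝ} (hK : 0 ≤ K) (hM : 0 ≤ M) (hξK : ∀ y, l1Norm y ≤ N → ξ y ≤ K)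
    (hwM : ∀ s ∈ Icc 0 δ, ∀ y, l1Norm y ≤ N → w s y ≤ M) (n : ℕ) {t : ℝ} (ht : t ∈ Icc 0 δ)
    {z : Fin d → ℤ} (hz : l1Norm z + n ≤ N) :
    w t z ≤ Real.exp (K * t) * (M * ((2 * d * t) ^ n / n.factorial)) := by
  induction n generalizing t z with
  | zero =>
    refine (hwM t ht z hz).trans ?_
    simpa using le_mul_of_one_le_left hM (Real.one_le_exp (mul_nonneg hK ht.1))
  | succ n ih =>
    have h := le_of_hasDerivAt_le (a := 0) (b := t)
      (f := fun r => Real.exp (-(K * r)) * w r z)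
      (g := fun r => M * ((2 * d * r) ^ (n + 1) / (n + 1).factorial))
      (f' := fun r => Real.exp (-(K * r)) * ((ξ z - 2 * d - K) * w r z + neighborSum (w r) z))
      (g' := fun r => 2 * d * (M * ((2 * d * r) ^ n / n.factorial)))
      ht.1 ?_ (by fun_prop) ?_ ?_ ?_ ?_
    · rw [Real.exp_neg, ← div_eq_inv_mul, div_le_iff₀' (Real.exp_pos _)] at h
      exact h
    · exact ContinuousOn.mul (by fun_prop) ((hw.continuousOn z).mono Icc_subset_Ici_self)
    · intro r hr
      have h1 := ((hasDerivAt_id' r).const_mul K).fun_neg.exp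
      exact (h1.fun_mul (hw.hasDerivAt r hr.1 z)).congr_deriv (by ring)
    · intro r _
      have h1 := (((((hasDerivAt_id' r).const_mul (2 * (d : ℝ))).fun_pow (n + 1)).div_const
        ((n + 1).factorial : ℝ)).const_mul M)
      refine h1.congr_deriv ?_
      have : ((n + 1).factorial : ℝ) = (n + 1) * n.factorial := by
        rw [Nat.factorial_succ]; push_cast; ring
      rw [this]
      have hk : (n.factorial : ℝ) ≠ 0 := by positivity
      simp only [Nat.add_sub_cancel]
      push_cast
      field_simp
    · simp [h0]
    · intro r hr
      have hr' : r ∈ Icc 0 δ := ⟨hr.1.le, hr.2.le.trans ht.2⟩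
      have h1 : neighborSum (w r) z ≤
          2 * d * (Real.exp (K * r) * (M * ((2 * d * r) ^ n / n.factorial))) :=
        neighborSum_le fun y hy => ih hr' (by omega)
      have h2 : (ξ z - 2 * d - K) * w r z ≤ 0 := by
        refine mul_nonpos_of_nonpos_of_nonneg ?_ (hw.nonneg r hr.1.le z)
        have := hξK z (by omega)
        have hd : (0 : ℝ) ≤ d := d.cast_nonneg
        linarith
      calc _ ≤ Real.exp (-(K * r)) *
            (2 * d * (Real.exp (K * r) * (M * ((2 * d * r) ^ n / n.factorial)))) :=
          mul_le_mul_of_nonneg_left (by linarith) (Real.exp_pos _).le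
        _ = Real.exp (-(K * r)) * Real.exp (K * r) *
            (2 * d * (M * ((2 * d * r) ^ n / n.factorial))) := by ring
        _ = _ := by rw [← Real.exp_add, neg_add_cancel, Real.exp_zero, one_mul]

end IsNonnegEvolution

/-- The sequence `n! / T^n` decreases up to `T` and increases afterwards, so up to the constant
`T^T` it may be treated as increasing. -/
lemma factorial_mul_pow_le {T m N : ℕ} (hT : 1 ≤ T) (hm : m ≤ N) :
    m.factorial * T ^ N ≤ T ^ T * T ^ m * N.factorial := by
  rcases le_total N T with h | h
  · have h1 : m.factorial ≤ N.factorial := Nat.factorial_le hm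
    have h2 : T ^ N ≤ T ^ T := Nat.pow_le_pow_right hT h
    have h3 : 1 ≤ T ^ m := Nat.one_le_pow _ _ hT
    calc m.factorial * T ^ N ≤ N.factorial * (T ^ T * T ^ m) :=
          Nat.mul_le_mul h1 (h2.trans (Nat.le_mul_of_pos_right _ h3))
      _ = _ := by ring
  · induction N, hm using Nat.le_induction with
    | base =>
      calc m.factorial * T ^ m = 1 * T ^ m * m.factorial := by ring
        _ ≤ T ^ T * T ^ m * m.factorial := by gcongr; exact Nat.one_le_pow _ _ hT
    | succ N hmN ih =>
      rcases h.eq_or_lt with h | h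
      · rw [← h]
        have h1 : m.factorial ≤ T.factorial := Nat.factorial_le (by omega)
        calc m.factorial * T ^ T ≤ T.factorial * (T ^ T * T ^ m) :=
              Nat.mul_le_mul h1 (Nat.le_mul_of_pos_right _ (Nat.one_le_pow _ _ hT))
          _ = _ := by ring
      · rw [pow_succ, Nat.factorial_succ]
        calc m.factorial * (T ^ N * T) = m.factorial * T ^ N * T := by ring
          _ ≤ T ^ T * T ^ m * N.factorial * (N + 1) := Nat.mul_le_mul (ih (by omega)) h.le
          _ = _ := by ring

namespace IsNonnegEvolution

variable {ξ : (Fin d → ℤ) → ℝ} {w : ℝ → (Fin d → ℤ) → ℝ}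

/-- Uniqueness of nonnegative evolutions, for potentials of at most linear growth. -/
lemma eq_zero (hw : IsNonnegEvolution ξ w) (h0 : ∀ z, w 0 z = 0) (hξ0 : ∀ z, 0 ≤ ξ z) {A : ℝ}
    (hξ : ∀ z, ξ z ≤ A + l1Norm z) {δ : ℝ} (hδ : 0 ≤ δ) (z : Fin d → ℤ) : w δ z = 0 := by
  have hA : 0 ≤ A := by
    have h := hξ 0
    rw [l1Norm_eq_zero.2 rfl] at h
    simpa using (hξ0 0).trans h
  -- This size of `T` makes the ratio `4 d δ e^δ / T` of the final geometric bound at most `1/2`;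
  -- the added one gives `T ≥ 1`.
  obtain ⟨T, hT⟩ := exists_nat_ge (8 * d * δ * Real.exp δ + 1)
  have hT1' : (1 : ℝ) ≤ T := le_trans (le_add_of_nonneg_left (by positivity)) hT
  have hT0 : (0 : ℝ) < T := by linarith
  have hT1 : 1 ≤ T := by exact_mod_cast hT1'
  set C : ℝ := Real.exp (2 * d * (δ + T)) * w (δ + T) 0
  have hC : 0 ≤ C := mul_nonneg (Real.exp_pos _).le (hw.nonneg _ (by positivity) _)
  -- Mass at `y` at time `s ≤ δ` has at least time `T` to reach the origin by time `δ + T`, where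
  -- the total is controlled by `C`.
  have hwle : ∀ N : ℕ, ∀ s ∈ Icc 0 δ, ∀ y, l1Norm y ≤ N →
      w s y ≤ C * (T ^ T * (N.factorial / T ^ N)) := by
    intro N s hs y hy
    have h1 := hw.pow_div_factorial_mul_le hξ0 (l1Norm y) hs.1
      (hs.2.trans (by linarith : δ ≤ δ + T)) (y := y) (z := 0) (by rw [zero_sub, l1Norm_neg])
    have h2 : (T : ℝ) ^ l1Norm y / (l1Norm y).factorial * w s y ≤ C := by
      refine le_trans (mul_le_mul_of_nonneg_right ?_ (hw.nonneg s hs.1 y)) (h1.trans ?_)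
      · have : (T : ℝ) ≤ δ + T - s := by linarith [hs.2]
        gcongr
      · refine mul_le_mul_of_nonneg_right (Real.exp_le_exp.2 ?_) (hw.nonneg _ (by positivity) _)
        have := hs.1
        gcongr
        linarith
    have h3 : ((l1Norm y).factorial : ℝ) * T ^ N ≤ T ^ T * T ^ l1Norm y * N.factorial := by
      exact_mod_cast factorial_mul_pow_le hT1 hy
    have h4 : ((l1Norm y).factorial : ℝ) / T ^ l1Norm y ≤ T ^ T * (N.factorial / T ^ N) := by
      rw [← mul_div_assoc, div_le_div_iff₀ (by positivity) (by positivity)]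
      linarith
    have h5 : w s y ≤ C * ((l1Norm y).factorial / T ^ l1Norm y) := by
      rw [div_mul_eq_mul_div, div_le_iff₀ (by positivity)] at h2
      rw [← mul_div_assoc, le_div_iff₀ (by positivity)]
      linarith
    exact h5.trans (mul_le_mul_of_nonneg_left h4 hC)
  set m := l1Norm z
  set D : ℝ := Real.exp ((A + m) * δ) * (C * T ^ T * m.factorial * 2 ^ m)
  have hbound : ∀ n : ℕ, w δ z ≤ D * (1 / 2) ^ n := by
    intro n
    -- In `n` steps only the ball of radius `m + n` is visited. The bound on the potential there
    -- costs `e^δ` per step, and the factorial in the a priori bound is offset by `1/n!`.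
    have h1 := hw.le_pow_div_factorial h0 (N := m + n) (K := A + (m + n : ℕ)) (by positivity)
      (by positivity) (fun y hy => (hξ y).trans (by gcongr)) (hwle (m + n)) n
      (t := δ) ⟨hδ, le_rfl⟩ (z := z) le_rfl
    have hfac : ((m + n).factorial : ℝ) ≤ m.factorial * n.factorial * 2 ^ (m + n) := by
      have h2 := Nat.add_choose_mul_factorial_mul_factorial m n
      have h3 := Nat.choose_le_two_pow (m + n) m
      have : (m + n).factorial ≤ m.factorial * n.factorial * 2 ^ (m + n) := by
        rw [← h2]
        calc _ = m.factorial * n.factorial * (m + n).choose m := by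
              rw [Nat.choose_symm_add]; ring
          _ ≤ _ := by gcongr
      exact_mod_cast this
    have hratio : Real.exp δ * (4 * d * δ) / T ≤ 1 / 2 := by
      rw [div_le_iff₀ hT0]
      linarith
    calc w δ z ≤ _ := h1
      _ ≤ Real.exp ((A + (m + n : ℕ)) * δ) * (C * (T ^ T *
          (m.factorial * n.factorial * 2 ^ (m + n) / T ^ n)) *
            ((2 * d * δ) ^ n / n.factorial)) := by
        have h2 : (T : ℝ) ^ n ≤ T ^ (m + n) := pow_le_pow_right₀ hT1' (by omega)
        gcongr
      _ = D * (Real.exp δ * (4 * d * δ) / T) ^ n := by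
        have h4 : Real.exp ((A + (m + n : ℕ)) * δ) =
            Real.exp ((A + m) * δ) * Real.exp δ ^ n := by
          rw [← Real.exp_nat_mul, ← Real.exp_add]
          congr 1
          push_cast
          ring
        have h5 : (4 * d * δ) ^ n = 2 ^ n * (2 * d * δ) ^ n := by
          rw [← mul_pow]; congr 1; ring
        rw [h4, div_pow, mul_pow (Real.exp δ), h5, pow_add]
        have hk : (n.factorial : ℝ) ≠ 0 := by positivity
        simp only [D]
        field_simp
      _ ≤ D * (1 / 2) ^ n := by
        gcongr
  have hlim : Tendsto (fun n : ℕ => D * (1 / 2 : ℝ) ^ n) atTop (𝓝 0) := by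
    simpa using (tendsto_pow_atTop_nhds_zero_of_lt_one (by norm_num : (0 : ℝ) ≤ 1 / 2)
      (by norm_num)).const_mul D
  exact le_antisymm (ge_of_tendsto' hlim hbound) (hw.nonneg δ hδ z)

end IsNonnegEvolution

/-- By minimality the difference is a nonnegative evolution started from zero, hence zero. -/
lemma IsNonnegSolution.eq_minimalSolution {ξ : (Fin d → ℤ) → ℝ} {u : ℝ → (Fin d → ℤ) → ℝ}
    (hu : IsNonnegSolution ξ u) (hξ0 : ∀ z, 0 ≤ ξ z) {A : ℝ} (hξ : ∀ z, ξ z ≤ A + l1Norm z)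
    {t : ℝ} (ht : 0 ≤ t) : u t = minimalSolution ξ t := by
  have hv : IsNonnegSolution ξ (minimalSolution ξ) :=
    isNonnegSolution_minimalSolution (A := A) zero_le_one (by simpa using hξ)
  have hw : IsNonnegEvolution ξ fun s z => u s z - minimalSolution ξ s z :=
    ⟨fun s hs z => sub_nonneg.2 (minimalSolution_le hu hs z),
      fun z => (hu.continuousOn z).sub (hv.continuousOn z), fun s hs z => by
        refine ((hu.hasDerivAt_neighborSum hs z).fun_sub
          (hv.hasDerivAt_neighborSum hs z)).congr_deriv ?_
        rw [neighborSum_sub]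
        ring⟩
  funext z
  exact sub_eq_zero.1 (hw.eq_zero (fun z => by rw [hu.initial, hv.initial, sub_self]) hξ0 hξ ht z)

/-- The strategy of walking to `z` within time `s`, and of staying there until time `t`. -/
lemma le_totalMass_minimalSolution {ξ : (Fin d → ℤ) → ℝ} (hξ0 : ∀ z, 0 ≤ ξ z) {A : ℝ}
    (hξ : ∀ z, ξ z ≤ A + l1Norm z) {s t : ℝ} (hs : 0 ≤ s) (hst : s ≤ t) (z : Fin d → ℤ) :
    Real.exp (ξ z * (t - s) - 2 * d * t) * (s ^ l1Norm z / (l1Norm z).factorial) ≤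
      totalMass (minimalSolution ξ) t := by
  have hξ' : ∀ z, ξ z ≤ A + 1 * l1Norm z := by simpa using hξ
  have hv := isNonnegSolution_minimalSolution zero_le_one hξ'
  have h1 := hv.isNonnegEvolution.pow_div_factorial_mul_le hξ0 (l1Norm z) le_rfl hs
    (y := 0) (z := z) (by rw [sub_zero])
  rw [hv.initial, if_pos rfl, mul_one, sub_zero] at h1
  have h2 := hv.isNonnegEvolution.exp_mul_le hs hst z
  have h3 : minimalSolution ξ t z ≤ totalMass (minimalSolution ξ) t :=
    (summable_minimalSolution zero_le_one hξ' (hs.trans hst)).le_tsum z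
      fun y _ => hv.nonneg t (hs.trans hst) y
  calc _ = Real.exp ((ξ z - 2 * d) * (t - s)) * Real.exp (-(2 * d * s)) *
        (s ^ l1Norm z / (l1Norm z).factorial) := by
        rw [← Real.exp_add]
        congr 2
        ring
    _ ≤ Real.exp ((ξ z - 2 * d) * (t - s)) * Real.exp (-(2 * d * s)) *
        (Real.exp (2 * d * s) * minimalSolution ξ s z) := by gcongr
    _ = Real.exp ((ξ z - 2 * d) * (t - s)) * minimalSolution ξ s z := by
        rw [mul_assoc, ← mul_assoc (Real.exp (-_)), ← Real.exp_add, neg_add_cancel, Real.exp_zero,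
          one_mul]
    _ ≤ _ := h2.trans h3

/-! ### Counting lattice points -/

/-- The ball of radius `n` around the origin in the `ℓ¹`-norm on `ℤ^d`. -/
noncomputable def l1Ball (d n : ℕ) : Finset (Fin d → ℤ) :=
  (Fintype.piFinset fun _ => Finset.Icc (-n : ℤ) n).filter fun z => l1Norm z ≤ n

lemma mem_l1Ball {d n : ℕ} {z : Fin d → ℤ} : z ∈ l1Ball d n ↔ l1Norm z ≤ n := by
  rw [l1Ball, Finset.mem_filter, and_iff_right_iff_imp]
  intro h
  rw [Fintype.mem_piFinset]
  intro i
  have : (z i).natAbs ≤ l1Norm z :=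
    Finset.single_le_sum (f := fun i => (z i).natAbs) (fun _ _ => Nat.zero_le _) (Finset.mem_univ i)
  rw [Finset.mem_Icc]
  omega

lemma card_l1Ball_le (d n : ℕ) : (l1Ball d n).card ≤ (2 * n + 1) ^ d := by
  refine (Finset.card_filter_le _ _).trans ?_
  rw [Fintype.card_piFinset]
  simp only [Int.card_Icc, Finset.prod_const, Finset.card_univ, Fintype.card_fin]
  gcongr
  omega

lemma l1Norm_eq_sum_abs {d : ℕ} (z : Fin d → ℤ) : (l1Norm z : ℝ) = ∑ i, |(z i : ℝ)| := by
  simp [l1Norm, Nat.cast_natAbs]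

open scoped Pointwise in
/-- The number of lattice points in a ball is asymptotically the volume of the cross-polytope. -/
lemma tendsto_card_l1Ball_div_pow {d : ℕ} (hd : 1 ≤ d) :
    Tendsto (fun n : ℕ => ((l1Ball d n).card : ℝ) / n ^ d) atTop
      (𝓝 (2 ^ d / (d.factorial : ℝ))) := by
  have : Nonempty (Fin d) := ⟨⟨0, hd⟩⟩
  set s : Set (Fin d → ℝ) := {x | ∑ i, |x i| ≤ 1} with hs
  have hvol : volume.real s = 2 ^ d / (d.factorial : ℝ) := by
    have h := MeasureTheory.volume_sum_rpow_le (ι := Fin d) (p := 1) le_rfl 1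
    simp only [Real.rpow_one, div_one, ENNReal.ofReal_one, one_pow, one_mul, Fintype.card_fin] at h
    rw [measureReal_def, h, ENNReal.toReal_ofReal, Real.Gamma_nat_eq_factorial]
    · norm_num [Real.Gamma_two]
    · have := Real.Gamma_nat_eq_factorial d
      rw [this]
      norm_num [Real.Gamma_two]
      positivity
  have hclosed : IsClosed s := isClosed_le (by fun_prop) continuous_const
  have hbdd : Bornology.IsBounded s := by
    refine (Metric.isBounded_closedBall (x := (0 : Fin d → ℝ)) (r := 1)).subset fun x hx => ?_
    rw [mem_closedBall_zero_iff, pi_norm_le_iff_of_nonneg zero_le_one]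
    intro i
    exact (Finset.single_le_sum (f := fun i => |x i|) (fun _ _ => abs_nonneg _)
      (Finset.mem_univ i)).trans hx
  -- Convexity serves to show that the frontier is a null set, as the lattice point count requires.
  have hconv : Convex ℝ s := by
    intro x hx y hy a b ha hb hab
    calc ∑ i, |(a • x + b • y) i| ≤ ∑ i, (a * |x i| + b * |y i|) := by
          refine Finset.sum_le_sum fun i _ => ?_
          simp only [Pi.add_apply, Pi.smul_apply, smul_eq_mul]
          refine (abs_add_le _ _).trans_eq ?_
          rw [abs_mul, abs_mul, abs_of_nonneg ha, abs_of_nonneg hb]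
      _ = a * ∑ i, |x i| + b * ∑ i, |y i| := by
          rw [Finset.sum_add_distrib, Finset.mul_sum, Finset.mul_sum]
      _ ≤ a * 1 + b * 1 := by
          have hx' : ∑ i, |x i| ≤ 1 := hx
          have hy' : ∑ i, |y i| ≤ 1 := hy
          gcongr
      _ = 1 := by linarith
  have h := tendsto_card_div_pow_atTop_volume s hbdd hclosed.measurableSet
    (hconv.addHaar_frontier volume)
  rw [hvol] at h
  refine h.congr' ?_
  filter_upwards [eventually_ge_atTop 1] with n hn
  have hn0 : (0 : ℝ) < n := by exact_mod_cast hn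
  rw [Fintype.card_fin]
  congr 2
  have hset : s ∩ (n : ℝ)⁻¹ • ↑(Submodule.span ℤ (range (Pi.basisFun ℝ (Fin d)))) =
      (fun (z : Fin d → ℤ) i => (n : ℝ)⁻¹ * z i) '' (l1Ball d n) := by
    ext x
    have habs : ∀ z : Fin d → ℤ, ∑ i, |(n : ℝ)⁻¹ * z i| = (n : ℝ)⁻¹ * l1Norm z := fun z => by
      rw [l1Norm_eq_sum_abs, Finset.mul_sum]
      exact Finset.sum_congr rfl fun i _ => by rw [abs_mul, abs_of_pos (inv_pos.2 hn0)]
    have hle : ∀ z : Fin d → ℤ, (n : ℝ)⁻¹ * l1Norm z ≤ 1 ↔ l1Norm z ≤ n := fun z => by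
      rw [inv_mul_le_iff₀ hn0, mul_one, Nat.cast_le]
    constructor
    · rintro ⟨hx, y, hy, rfl⟩
      rw [SetLike.mem_coe, Module.Basis.mem_span_iff_repr_mem] at hy
      choose z hz using hy
      simp only [Pi.basisFun_repr] at hz
      have hxz : (fun y => (n : ℝ)⁻¹ • y) y = fun i => (n : ℝ)⁻¹ * z i := by
        funext i
        simp [← hz i]
      refine ⟨z, ?_, hxz.symm⟩
      rw [hxz, hs, mem_ofPred_eq, habs, hle] at hx
      exact mem_l1Ball.2 hx
    · rintro ⟨z, hz, rfl⟩
      refine ⟨?_, fun i => (z i : ℝ), ?_, rfl⟩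
      · rw [hs, mem_ofPred_eq, habs, hle]
        exact mem_l1Ball.1 hz
      · rw [SetLike.mem_coe, Module.Basis.mem_span_iff_repr_mem]
        exact fun i => ⟨z i, rfl⟩
  have hinj : Function.Injective fun (z : Fin d → ℤ) i => (n : ℝ)⁻¹ * (z i : ℝ) := by
    intro z z' h
    funext i
    have := congrFun h i
    simpa [hn0.ne'] using this
  rw [hset, Nat.card_image_of_injective hinj, Nat.card_coe_set_eq, Set.ncard_coe_finset]

lemma tendsto_card_l1Ball_floor {d : ℕ} (hd : 1 ≤ d) {ι : Type*} {l : Filter ι} {r : ι → ℝ}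
    (hr : Tendsto r l atTop) {x : ℝ} (hx : 0 < x) :
    Tendsto (fun t => ((l1Ball d ⌊x * r t⌋₊).card : ℝ) / r t ^ d) l
      (𝓝 (2 ^ d / (d.factorial : ℝ) * x ^ d)) := by
  have h1 : Tendsto (fun t => ⌊x * r t⌋₊) l atTop :=
    tendsto_nat_floor_atTop.comp (hr.const_mul_atTop hx)
  have h2 := ((tendsto_nat_floor_mul_div_atTop hx.le).comp hr).pow d
  refine (((tendsto_card_l1Ball_div_pow hd).comp h1).mul h2).congr' ?_
  filter_upwards [h1.eventually_ge_atTop 1] with t ht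
  have : ((⌊x * r t⌋₊ : ℕ) : ℝ) ≠ 0 := by positivity
  simp only [Function.comp_apply]
  rw [div_pow]
  field_simp

/-! ### Beta-type integrals on the half line -/

section Integrals

variable {α β y q : ℝ}

lemma hasDerivAt_neg_rpow (hy : 0 < y) (hq : 0 < q) {x : ℝ} (hx : 0 ≤ x) :
    HasDerivAt (fun x => -(y + q * x) ^ (-α)) (α * q * (y + q * x) ^ (-α - 1)) x := by
  have h : y + q * x ≠ 0 := by positivity
  have h1 := ((((hasDerivAt_id' x).const_mul q).const_add y).rpow_const (p := -α) (Or.inl h)).fun_neg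
  exact h1.congr_deriv (by ring)

lemma tendsto_neg_rpow (hα : 0 < α) (hq : 0 < q) :
    Tendsto (fun x => -(y + q * x) ^ (-α)) atTop (𝓝 0) := by
  have h1 : Tendsto (fun x => y + q * x) atTop atTop :=
    tendsto_atTop_add_const_left _ _ (tendsto_id.const_mul_atTop hq)
  simpa using ((tendsto_rpow_neg_atTop hα).comp h1).neg

lemma integrableOn_mul_rpow (hα : 0 < α) (hy : 0 < y) (hq : 0 < q) {a : ℝ} (ha : 0 ≤ a) :
    IntegrableOn (fun x => α * q * (y + q * x) ^ (-α - 1)) (Ioi a) := by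
  refine integrableOn_Ioi_deriv_of_nonneg' (fun x hx => hasDerivAt_neg_rpow hy hq (ha.trans hx))
    (fun x hx => ?_) (tendsto_neg_rpow hα hq)
  have : 0 ≤ x := ha.trans (mem_Ioi.1 hx).le
  positivity

lemma integral_mul_rpow (hα : 0 < α) (hy : 0 < y) (hq : 0 < q) {a : ℝ} (ha : 0 ≤ a) :
    ∫ x in Ioi a, α * q * (y + q * x) ^ (-α - 1) = (y + q * a) ^ (-α) := by
  rw [integral_Ioi_of_hasDerivAt_of_tendsto' (fun x hx => hasDerivAt_neg_rpow hy hq (ha.trans hx))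
    (integrableOn_mul_rpow hα hy hq ha) (tendsto_neg_rpow hα hq)]
  ring

lemma pow_mul_rpow_le (n : ℕ) {x : ℝ} (hx : 0 ≤ x) :
    x ^ n * (1 + x) ^ (-β) ≤ (1 + x) ^ (n - β) := by
  have h1 : 0 < 1 + x := by positivity
  rw [sub_eq_add_neg, Real.rpow_add h1, Real.rpow_natCast]
  gcongr
  linarith

lemma integrableOn_one_add_rpow (hβ : 1 < β) :
    IntegrableOn (fun x : ℝ => (1 + x) ^ (-β)) (Ioi 0) := by
  simpa only [add_comm] using
    integrableOn_add_rpow_Ioi_of_lt (a := -β) (c := 0) (m := 1) (by linarith) (by norm_num)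

lemma integrableOn_pow_mul_rpow (n : ℕ) (hβ : n + 1 < β) :
    IntegrableOn (fun x : ℝ => x ^ n * (1 + x) ^ (-β)) (Ioi 0) := by
  have h := integrableOn_one_add_rpow (β := β - n) (by linarith)
  refine Integrable.mono' h ?_ ?_
  · exact Measurable.aestronglyMeasurable (by fun_prop)
  · refine (ae_restrict_iff' measurableSet_Ioi).2 (Eventually.of_forall fun x hx => ?_)
    have hx0 : 0 ≤ x := (mem_Ioi.1 hx).le
    rw [Real.norm_of_nonneg (by positivity), neg_sub]
    exact pow_mul_rpow_le n hx0

/-- Euler's integral of the first kind over the half line, with one integer parameter. -/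
lemma integral_pow_mul_rpow (n : ℕ) (hβ : n + 1 < β) :
    ∫ x in Ioi (0 : ℝ), x ^ n * (1 + x) ^ (-β) =
      n.factorial * Real.Gamma (β - n - 1) / Real.Gamma β := by
  induction n generalizing β with
  | zero =>
    have hβ1 : 0 < β - 1 := by push_cast at hβ; linarith
    have h := integral_mul_rpow (α := β - 1) (y := 1) (q := 1) hβ1 one_pos one_pos (le_refl 0)
    have h2 : (∫ x in Ioi (0 : ℝ), (1 + x) ^ (-β)) = 1 / (β - 1) := by
      rw [eq_div_iff hβ1.ne', mul_comm, ← integral_const_mul]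
      have : -(β - 1) - 1 = -β := by ring
      simpa [this] using h
    have hΓ : Real.Gamma β = (β - 1) * Real.Gamma (β - 1) := by
      rw [← Real.Gamma_add_one hβ1.ne', sub_add_cancel]
    have hΓ0 := (Real.Gamma_pos_of_pos hβ1).ne'
    simp only [pow_zero, one_mul, Nat.factorial_zero, Nat.cast_one, Nat.cast_zero, sub_zero]
    rw [h2, hΓ]
    field_simp
  | succ n ih =>
    push_cast at hβ
    have hβ1 : 0 < β - 1 := by linarith [n.cast_nonneg (α := ℝ)]
    have hi1 := integrableOn_pow_mul_rpow n (β := β - 1) (by linarith)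
    have hi2 := integrableOn_pow_mul_rpow (n + 1) (β := β) (by push_cast; linarith)
    -- Integration by parts: both boundary terms vanish, which lowers the power of `x` and `β` by
    -- one each.
    have hderiv : ∀ x ∈ Ici (0 : ℝ), HasDerivAt (fun x => x ^ (n + 1) * (1 + x) ^ (-(β - 1)))
        ((n + 1) * (x ^ n * (1 + x) ^ (-(β - 1))) - (β - 1) * (x ^ (n + 1) * (1 + x) ^ (-β))) x := by
      intro x hx
      have h : 1 + x ≠ 0 := by have := mem_Ici.1 hx; positivity
      have h1 := ((hasDerivAt_id' x).const_add 1).rpow_const (p := -(β - 1)) (Or.inl h)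
      refine (((hasDerivAt_id' x).fun_pow (n + 1)).fun_mul h1).congr_deriv ?_
      rw [show -(β - 1) - 1 = -β by ring]
      simp only [Nat.add_sub_cancel]
      push_cast
      ring
    have hlim : Tendsto (fun x : ℝ => x ^ (n + 1) * (1 + x) ^ (-(β - 1))) atTop (𝓝 0) := by
      have h1 : Tendsto (fun x : ℝ => (1 + x) ^ (-(β - 1 - (n + 1)))) atTop (𝓝 0) :=
        (tendsto_rpow_neg_atTop (by linarith)).comp (tendsto_atTop_add_const_left _ _ tendsto_id)
      refine squeeze_zero' ?_ ?_ h1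
      · filter_upwards [eventually_ge_atTop 0] with x hx
        positivity
      · filter_upwards [eventually_ge_atTop 0] with x hx
        have := pow_mul_rpow_le (β := β - 1) (n + 1) hx
        push_cast at this
        rwa [neg_sub (β - 1)]
    have h := integral_Ioi_of_hasDerivAt_of_tendsto' hderiv
      ((hi1.const_mul _).sub (hi2.const_mul _)) hlim
    rw [integral_sub (hi1.const_mul _) (hi2.const_mul _), integral_const_mul, integral_const_mul,
      ih (by linarith)] at h
    have hΓ : Real.Gamma β = (β - 1) * Real.Gamma (β - 1) := by
      rw [← Real.Gamma_add_one hβ1.ne', sub_add_cancel]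
    have hΓ0 := (Real.Gamma_pos_of_pos hβ1).ne'
    rw [hΓ, Nat.factorial_succ]
    push_cast
    rw [show β - (n + 1) - 1 = β - 1 - n - 1 by ring]
    have h3 : (β - 1) * ∫ x in Ioi (0 : ℝ), x ^ (n + 1) * (1 + x) ^ (-β) =
        (n + 1) * (n.factorial * Real.Gamma (β - 1 - n - 1) / Real.Gamma (β - 1)) := by
      simp only [ne_eq, Nat.add_eq_zero_iff, one_ne_zero, and_false, not_false_eq_true, zero_pow,
        zero_mul, sub_zero] at h
      linarith
    field_simp at h3 ⊢
    linarith

/-- The substitution `x ↦ (q / y) x` reduces this to `y = q = 1`. -/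
lemma integral_pow_mul_rpow_add_mul (n : ℕ) (hβ : n + 1 < β) (hy : 0 < y) (hq : 0 < q) :
    ∫ x in Ioi (0 : ℝ), x ^ n * (y + q * x) ^ (-β) =
      (y / q) ^ (n + 1) * y ^ (-β) * (n.factorial * Real.Gamma (β - n - 1) / Real.Gamma β) := by
  have h := integral_comp_mul_left_Ioi (fun x => x ^ n * (1 + x) ^ (-β)) 0 (div_pos hq hy)
  rw [mul_zero, integral_pow_mul_rpow n hβ, smul_eq_mul] at h
  rw [mul_right_comm, pow_succ, mul_assoc _ (y / q), ← inv_div q y, ← h, mul_comm (_ * _),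
    mul_left_comm, ← integral_const_mul, ← integral_const_mul]
  refine setIntegral_congr_fun measurableSet_Ioi fun x hx => ?_
  have hx0 : 0 < x := hx
  have h1 : 1 + q / y * x = (y + q * x) / y := by field_simp
  rw [h1, Real.div_rpow (by positivity) hy.le, mul_pow, inv_pow]
  have : y ^ (-β) ≠ 0 := by positivity
  field_simp

end Integrals

lemma frechetConst_eq {d : ℕ} (hd : 1 ≤ d) {α : ℝ} :
    frechetConst d α =
      ((α - d) / d) ^ d * 2 ^ d * (Real.Gamma (α - d) / Real.Gamma α) := by
  obtain ⟨k, rfl⟩ : ∃ k, d = k + 1 := ⟨d - 1, by omega⟩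
  have h : Real.Gamma ((k + 1 : ℕ) : ℝ) = k.factorial := by
    push_cast
    exact Real.Gamma_nat_eq_factorial k
  rw [frechetConst, ProbabilityTheory.beta, h, sub_add_cancel, Nat.add_sub_cancel]
  have h2 : (k.factorial : ℝ) ≠ 0 := by positivity
  rw [div_pow]
  field_simp

/-- Here the constant `θ` arises: it is multiplied by a factor equal to one exactly at the critical
slope `q = d/(α - d)`. -/
lemma integral_volume_mul_rpow {d : ℕ} (hd : 1 ≤ d) {α y q : ℝ} (hα : d < α) (hy : 0 < y)
    (hq : 0 < q) :
    ∫ x in Ioi (0 : ℝ), 2 ^ d / (d.factorial : ℝ) * x ^ d * (α * q * (y + q * x) ^ (-α - 1)) =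
      frechetConst d α * (d / (α - d) / q) ^ d * y ^ (d - α) := by
  have hd0 : (0 : ℝ) < d := by exact_mod_cast hd
  have hα0 : 0 < α := hd0.trans hα
  have hαd : 0 < α - d := sub_pos.2 hα
  have h := integral_pow_mul_rpow_add_mul (β := α + 1) d (by linarith) hy hq
  rw [show -(α + 1) = -α - 1 by ring, show α + 1 - d - 1 = α - d by ring,
    Real.Gamma_add_one hα0.ne'] at h
  have h1 : ∀ x : ℝ, 2 ^ d / (d.factorial : ℝ) * x ^ d * (α * q * (y + q * x) ^ (-α - 1)) =
      2 ^ d / (d.factorial : ℝ) * α * q * (x ^ d * (y + q * x) ^ (-α - 1)) := fun x => by ring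
  simp_rw [h1]
  rw [integral_const_mul, h, frechetConst_eq hd]
  have h2 : y ^ (d - α) = y ^ (d + 1) * y ^ (-α - 1) := by
    rw [← Real.rpow_natCast, ← Real.rpow_add hy]
    congr 1
    push_cast
    ring
  have h3 : Real.Gamma α ≠ 0 := (Real.Gamma_pos_of_pos hα0).ne'
  have h4 : (d.factorial : ℝ) ≠ 0 := by positivity
  rw [h2, div_pow, div_pow, div_pow, div_pow]
  field_simp
  ring

/-! ### Convergence of sums of tail probabilities under a cone -/

section RiemannSums

variable {d : ℕ} {α y q : ℝ}

lemma card_l1Ball_floor_div_le (d : ℕ) {r x : ℝ} (hr : 1 ≤ r) (hx : 0 ≤ x) :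
    ((l1Ball d ⌊x * r⌋₊).card : ℝ) / r ^ d ≤ (2 * x + 1) ^ d := by
  have hr0 : 0 < r := by linarith
  rw [div_le_iff₀ (by positivity), ← mul_pow]
  have h1 : ((l1Ball d ⌊x * r⌋₊).card : ℝ) ≤ (2 * (⌊x * r⌋₊ : ℝ) + 1) ^ d := by
    exact_mod_cast card_l1Ball_le d _
  refine h1.trans (pow_le_pow_left₀ (by positivity) ?_ d)
  have := Nat.floor_le (mul_nonneg hx hr0.le)
  linarith

/-- This is the dominating function for the rescaled counts. It decays like `x^{d - α - 1}`, which
is where `α > d` enters. -/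
lemma integrableOn_two_mul_add_one_pow_mul (hα : d < α) (hy : 0 < y) (hq : 0 < q) :
    IntegrableOn (fun x => (2 * x + 1) ^ d * (α * q * (y + q * x) ^ (-α - 1))) (Ioi 0) := by
  have hα0 : 0 < α := (Nat.cast_nonneg d).trans_lt hα
  set m := min y q
  have hm : 0 < m := lt_min hy hq
  have h := (integrableOn_one_add_rpow (β := α + 1 - d) (by linarith)).const_mul
    (2 ^ d * (α * q * m ^ (-α - 1)))
  refine Integrable.mono' h (Measurable.aestronglyMeasurable (by fun_prop)) ?_
  refine (ae_restrict_iff' measurableSet_Ioi).2 (Eventually.of_forall fun x hx => ?_)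
  have hx0 : 0 < x := hx
  have h1 : 0 < 1 + x := by positivity
  rw [Real.norm_of_nonneg (by positivity)]
  have h2 : (y + q * x) ^ (-α - 1) ≤ m ^ (-α - 1) * (1 + x) ^ (-α - 1) := by
    rw [← Real.mul_rpow hm.le h1.le]
    refine Real.rpow_le_rpow_of_nonpos (by positivity) ?_ (by linarith)
    have h3 : m ≤ y := min_le_left _ _
    have h4 : m * x ≤ q * x := mul_le_mul_of_nonneg_right (min_le_right _ _) hx0.le
    linarith
  have h5 : (2 * x + 1) ^ d ≤ 2 ^ d * (1 + x) ^ d := by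
    rw [← mul_pow]
    exact pow_le_pow_left₀ (by positivity) (by linarith) d
  have h6 : (1 + x) ^ (-(α + 1 - d)) = (1 + x) ^ d * (1 + x) ^ (-α - 1) := by
    rw [← Real.rpow_natCast, ← Real.rpow_add h1]
    congr 1
    ring
  rw [h6]
  calc (2 * x + 1) ^ d * (α * q * (y + q * x) ^ (-α - 1))
      ≤ 2 ^ d * (1 + x) ^ d * (α * q * (m ^ (-α - 1) * (1 + x) ^ (-α - 1))) := by gcongr
    _ = _ := by ring

/-- The layer-cake representation of a sum over lattice points. -/
lemma sum_rpow_eq_integral (hα : 0 < α) (hy : 0 < y) (hq : 0 < q) {r : ℝ} (hr : 0 < r)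
    (F : Finset (Fin d → ℤ)) :
    ∑ z ∈ F, (y + q * (l1Norm z / r)) ^ (-α) =
      ∫ x in Ioi 0, ((F.filter fun z => (l1Norm z : ℝ) ≤ x * r).card : ℝ) *
        (α * q * (y + q * x) ^ (-α - 1)) := by
  have hset : ∀ a : ℝ, 0 ≤ a → (Ioi (0 : ℝ) ∩ Ici a : Set ℝ) =ᵐ[volume] Ioi a := by
    intro a ha
    refine EventuallyLE.antisymm ?_
      (LE.le.eventuallyLE fun x hx => ⟨ha.trans_lt hx, (mem_Ioi.1 hx).le⟩)
    exact (LE.le.eventuallyLE (inter_subset_right : Ioi (0 : ℝ) ∩ Ici a ⊆ Ici a)).trans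
      Ioi_ae_eq_Ici.symm.le
  have hint : ∀ z : Fin d → ℤ, (y + q * (l1Norm z / r)) ^ (-α) =
      ∫ x in Ioi 0, (Ici (l1Norm z / r : ℝ)).indicator
        (fun x => α * q * (y + q * x) ^ (-α - 1)) x := by
    intro z
    have ha : (0 : ℝ) ≤ l1Norm z / r := by positivity
    rw [setIntegral_indicator measurableSet_Ici, setIntegral_congr_set (hset _ ha),
      integral_mul_rpow hα hy hq ha]
  rw [Finset.sum_congr rfl fun z _ => hint z, ← integral_finsetSum]
  · refine integral_congr_ae (Eventually.of_forall fun x => ?_)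
    beta_reduce
    rw [Finset.card_filter]
    push_cast
    rw [Finset.sum_mul]
    refine Finset.sum_congr rfl fun z _ => ?_
    simp only [indicator_apply, mem_Ici, div_le_iff₀ hr, ite_mul, one_mul, zero_mul]
  · exact fun z _ => (integrableOn_mul_rpow hα hy hq le_rfl).indicator measurableSet_Ici

lemma integrableOn_card_mul_rpow (hα : d < α) (hy : 0 < y) (hq : 0 < q) {r : ℝ} (hr : 1 ≤ r) :
    IntegrableOn (fun x => ((l1Ball d ⌊x * r⌋₊).card : ℝ) / r ^ d *
      (α * q * (y + q * x) ^ (-α - 1))) (Ioi 0) := by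
  have hα0 : 0 < α := (Nat.cast_nonneg d).trans_lt hα
  refine Integrable.mono' (integrableOn_two_mul_add_one_pow_mul hα hy hq) ?_ ?_
  · refine Measurable.aestronglyMeasurable (Measurable.mul (Measurable.div_const ?_ _) (by fun_prop))
    exact (measurable_from_nat (f := fun n : ℕ => ((l1Ball d n).card : ℝ))).comp
      (Nat.measurable_floor.comp (by fun_prop))
  · refine (ae_restrict_iff' measurableSet_Ioi).2 (Eventually.of_forall fun x hx => ?_)
    have hx0 : 0 < x := hx
    rw [Real.norm_of_nonneg (by positivity)]
    exact mul_le_mul_of_nonneg_right (card_l1Ball_floor_div_le d hr hx0.le) (by positivity)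

lemma sum_rpow_div_le (hα : d < α) (hy : 0 < y) (hq : 0 < q) {r : ℝ} (hr : 1 ≤ r)
    (F : Finset (Fin d → ℤ)) :
    (∑ z ∈ F, (y + q * (l1Norm z / r)) ^ (-α)) / r ^ d ≤
      ∫ x in Ioi 0, ((l1Ball d ⌊x * r⌋₊).card : ℝ) / r ^ d *
        (α * q * (y + q * x) ^ (-α - 1)) := by
  have hα0 : 0 < α := (Nat.cast_nonneg d).trans_lt hα
  have hr0 : 0 < r := by linarith
  rw [sum_rpow_eq_integral hα0 hy hq hr0, div_eq_inv_mul, ← integral_const_mul]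
  refine integral_mono_of_nonneg ?_ (integrableOn_card_mul_rpow hα hy hq hr) ?_
  · refine (ae_restrict_iff' measurableSet_Ioi).2 (Eventually.of_forall fun x hx => ?_)
    have hx0 : 0 < x := hx
    simp only [Pi.zero_apply]
    positivity
  · refine (ae_restrict_iff' measurableSet_Ioi).2 (Eventually.of_forall fun x hx => ?_)
    have hx0 : 0 < x := hx
    beta_reduce
    rw [← mul_assoc, ← div_eq_inv_mul]
    have : (F.filter fun z => (l1Norm z : ℝ) ≤ x * r).card ≤ (l1Ball d ⌊x * r⌋₊).card := by
      refine Finset.card_le_card fun z hz => ?_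
      rw [mem_l1Ball]
      exact Nat.le_floor (Finset.mem_filter.1 hz).2
    gcongr

lemma le_sum_rpow_div (hα : 0 < α) (hy : 0 < y) (hq : 0 < q) {r : ℝ} (hr : 0 < r) (κ : ℝ) :
    ∫ x in Ioi 0, (Iic κ).indicator (fun x => ((l1Ball d ⌊x * r⌋₊).card : ℝ) / r ^ d *
        (α * q * (y + q * x) ^ (-α - 1))) x ≤
      (∑ z ∈ l1Ball d ⌊κ * r⌋₊, (y + q * (l1Norm z / r)) ^ (-α)) / r ^ d := by
  rw [sum_rpow_eq_integral hα hy hq hr, div_eq_inv_mul, ← integral_const_mul]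
  refine integral_mono_of_nonneg ?_ ?_ ?_
  · refine (ae_restrict_iff' measurableSet_Ioi).2 (Eventually.of_forall fun x hx => ?_)
    have hx0 : 0 < x := hx
    exact indicator_apply_nonneg fun _ => by positivity
  · refine Integrable.const_mul ?_ _
    refine Integrable.mono' ((integrableOn_mul_rpow hα hy hq le_rfl).const_mul
      ((l1Ball d ⌊κ * r⌋₊).card : ℝ)) ?_ ?_
    · refine Measurable.aestronglyMeasurable (Measurable.mul ?_ (by fun_prop))
      simp only [Finset.card_filter]
      push_cast
      refine Finset.measurable_sum _ fun z _ => Measurable.ite ?_ measurable_const measurable_const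
      exact measurableSet_le measurable_const (by fun_prop)
    · refine (ae_restrict_iff' measurableSet_Ioi).2 (Eventually.of_forall fun x hx => ?_)
      have hx0 : 0 < x := hx
      rw [Real.norm_of_nonneg (by positivity)]
      refine mul_le_mul_of_nonneg_right ?_ (by positivity)
      exact_mod_cast Finset.card_filter_le _ _
  · refine (ae_restrict_iff' measurableSet_Ioi).2 (Eventually.of_forall fun x hx => ?_)
    have hx0 : 0 < x := hx
    beta_reduce
    rw [indicator_apply, ← mul_assoc (r ^ d)⁻¹, ← div_eq_inv_mul]
    split_ifs with hxκ
    · have : (l1Ball d ⌊x * r⌋₊).card ≤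
          ((l1Ball d ⌊κ * r⌋₊).filter fun z => (l1Norm z : ℝ) ≤ x * r).card := by
        refine Finset.card_le_card fun z hz => ?_
        rw [mem_l1Ball] at hz
        rw [Finset.mem_filter, mem_l1Ball]
        refine ⟨hz.trans (Nat.floor_le_floor (mul_le_mul_of_nonneg_right hxκ hr.le)), ?_⟩
        exact (Nat.cast_le.2 hz).trans (Nat.floor_le (by positivity))
      gcongr
    · positivity

/-- The exhausting sets `S t` cover both uses at once: the whole half line for the upper sums and
`Iic (κ t)` for the sums over growing balls. -/
lemma tendsto_integral_card_mul_rpow (hd : 1 ≤ d) (hα : d < α) (hy : 0 < y) (hq : 0 < q)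
    {ι : Type*} {l : Filter ι} [l.IsCountablyGenerated] {r : ι → ℝ} (hr : Tendsto r l atTop)
    {S : ι → Set ℝ} (hS : ∀ t, MeasurableSet (S t)) (hS' : ∀ x, ∀ᶠ t in l, x ∈ S t) :
    Tendsto (fun t => ∫ x in Ioi 0, (S t).indicator (fun x =>
        ((l1Ball d ⌊x * r t⌋₊).card : ℝ) / r t ^ d * (α * q * (y + q * x) ^ (-α - 1))) x) l
      (𝓝 (frechetConst d α * (d / (α - d) / q) ^ d * y ^ (d - α))) := by
  have hα0 : 0 < α := (Nat.cast_nonneg d).trans_lt hα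
  rw [← integral_volume_mul_rpow hd hα hy hq]
  refine tendsto_integral_filter_of_dominated_convergence _ ?_ ?_
    (integrableOn_two_mul_add_one_pow_mul hα hy hq) ?_
  · filter_upwards [hr.eventually_ge_atTop 1] with t ht
    exact ((integrableOn_card_mul_rpow hα hy hq ht).indicator (hS t)).aestronglyMeasurable
  · filter_upwards [hr.eventually_ge_atTop 1] with t ht
    refine (ae_restrict_iff' measurableSet_Ioi).2 (Eventually.of_forall fun x hx => ?_)
    have hx0 : 0 < x := hx
    refine (norm_indicator_le_norm_self _ _).trans ?_
    have : 0 < r t := by linarith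
    rw [Real.norm_of_nonneg (by positivity)]
    exact mul_le_mul_of_nonneg_right (card_l1Ball_floor_div_le d ht hx0.le) (by positivity)
  · refine (ae_restrict_iff' measurableSet_Ioi).2 (Eventually.of_forall fun x hx => ?_)
    refine Tendsto.congr' ?_ ((tendsto_card_l1Ball_floor hd hr hx).mul_const _)
    filter_upwards [hS' x] with t ht
    rw [indicator_of_mem ht]

lemma exists_tendsto_sum_rpow_le (hd : 1 ≤ d) (hα : d < α) (hy : 0 < y) (hq : 0 < q)
    {ι : Type*} {l : Filter ι} [l.IsCountablyGenerated] {r : ι → ℝ} (hr : Tendsto r l atTop) :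
    ∃ S : ι → ℝ, Tendsto S l (𝓝 (frechetConst d α * (d / (α - d) / q) ^ d * y ^ (d - α))) ∧
      ∀ᶠ t in l, ∀ F : Finset (Fin d → ℤ),
        (∑ z ∈ F, (y + q * (l1Norm z / r t)) ^ (-α)) / r t ^ d ≤ S t := by
  refine ⟨_, tendsto_integral_card_mul_rpow hd hα hy hq hr (S := fun _ => univ)
    (fun _ => MeasurableSet.univ) (fun _ => Eventually.of_forall fun _ => mem_univ _), ?_⟩
  filter_upwards [hr.eventually_ge_atTop 1] with t ht F
  simp only [indicator_univ]
  exact sum_rpow_div_le hα hy hq ht F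

lemma exists_tendsto_le_sum_rpow (hd : 1 ≤ d) (hα : d < α) (hy : 0 < y) (hq : 0 < q)
    {ι : Type*} {l : Filter ι} [l.IsCountablyGenerated] {r κ : ι → ℝ} (hr : Tendsto r l atTop)
    (hκ : Tendsto κ l atTop) :
    ∃ S : ι → ℝ, Tendsto S l (𝓝 (frechetConst d α * (d / (α - d) / q) ^ d * y ^ (d - α))) ∧
      ∀ᶠ t in l, S t ≤
        (∑ z ∈ l1Ball d ⌊κ t * r t⌋₊, (y + q * (l1Norm z / r t)) ^ (-α)) / r t ^ d := by
  refine ⟨_, tendsto_integral_card_mul_rpow hd hα hy hq hr (S := fun t => Iic (κ t))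
    (fun _ => measurableSet_Iic) (fun x => hκ.eventually_ge_atTop x), ?_⟩
  filter_upwards [hr.eventually_gt_atTop 0] with t ht
  exact le_sum_rpow_div ((Nat.cast_nonneg d).trans_lt hα) hy hq ht _

end RiemannSums

/-! ### Probability that a Pareto potential lies below a cone -/

section Pareto

variable {Ω : Type*} [MeasurableSpace Ω] {P : Measure Ω} {d : ℕ} {α : ℝ}
  {ξ : (Fin d → ℤ) → Ω → ℝ}

lemma measureReal_forall_mem_le (hindep : iIndepFun ξ P)
    (hdist : ∀ z, ∀ x : ℝ, 1 ≤ x → P.real {ω | ξ z ω ≤ x} = 1 - x ^ (-α))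
    (F : Finset (Fin d → ℤ)) {b : (Fin d → ℤ) → ℝ} (hb : ∀ z, 1 ≤ b z) :
    P.real {ω | ∀ z ∈ F, ξ z ω ≤ b z} = ∏ z ∈ F, (1 - b z ^ (-α)) := by
  have h := hindep.measure_inter_preimage_eq_mul F (sets := fun z => Iic (b z))
    fun _ _ => measurableSet_Iic
  have hset : {ω | ∀ z ∈ F, ξ z ω ≤ b z} = ⋂ z ∈ F, ξ z ⁻¹' Iic (b z) := by ext ω; simp
  rw [hset, measureReal_def, h, ENNReal.toReal_prod]
  exact Finset.prod_congr rfl fun z _ => hdist z (b z) (hb z)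

lemma ae_one_lt [IsProbabilityMeasure P]
    (hdist : ∀ z, ∀ x : ℝ, 1 ≤ x → P.real {ω | ξ z ω ≤ x} = 1 - x ^ (-α)) :
    ∀ᵐ ω ∂P, ∀ z, 1 < ξ z ω := by
  rw [ae_all_iff]
  intro z
  have h := hdist z 1 le_rfl
  rw [Real.one_rpow, sub_self, measureReal_eq_zero_iff] at h
  rw [ae_iff]
  simpa only [not_lt] using h

/-- A Pareto potential with `α > d` almost surely grows at most linearly. -/
lemma ae_exists_le_add_l1Norm [IsProbabilityMeasure P] (hα : d < α) (hmeas : ∀ z, Measurable (ξ z))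
    (hdist : ∀ z, ∀ x : ℝ, 1 ≤ x → P.real {ω | ξ z ω ≤ x} = 1 - x ^ (-α)) :
    ∀ᵐ ω ∂P, ∃ A, ∀ z, ξ z ω ≤ A + l1Norm z := by
  have hprob : ∀ z, P {ω | 1 + (l1Norm z : ℝ) < ξ z ω} =
      ENNReal.ofReal ((1 + (l1Norm z : ℝ)) ^ (-α)) := by
    intro z
    have h1 := hdist z (1 + l1Norm z) (by simp)
    have h2 : {ω | 1 + (l1Norm z : ℝ) < ξ z ω} = {ω | ξ z ω ≤ 1 + (l1Norm z : ℝ)}ᶜ := by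
      ext ω; simp
    have h3 : MeasurableSet {ω | ξ z ω ≤ 1 + (l1Norm z : ℝ)} :=
      measurableSet_le (hmeas z) measurable_const
    have h4 := probReal_compl_eq_one_sub (μ := P) h3
    rw [h1, sub_sub_cancel, ← h2] at h4
    rw [← h4, ofReal_measureReal]
  -- The bound on finite cone sums, at height, slope and scale one, already gives summability;
  -- Borel–Cantelli then leaves finitely many exceptional sites.
  have hsum : Summable fun z : Fin d → ℤ => (1 + (l1Norm z : ℝ)) ^ (-α) := by
    have h := sum_rpow_div_le hα one_pos one_pos (le_refl 1)
    simp only [div_one, one_pow, one_mul] at h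
    exact summable_of_sum_le (fun z => by positivity) h
  have hfin : ∑' z, P {ω | 1 + (l1Norm z : ℝ) < ξ z ω} ≠ ⊤ := by
    simp_rw [hprob]
    exact hsum.tsum_ofReal_ne_top
  filter_upwards [ae_finite_setOfPred_mem hfin] with ω hω
  obtain ⟨B, hB⟩ := (hω.image fun z => ξ z ω).bddAbove
  refine ⟨max 1 B, fun z => ?_⟩
  rcases le_or_gt (ξ z ω) (1 + l1Norm z) with h | h
  · exact h.trans (by gcongr; exact le_max_left _ _)
  · have h1 : ξ z ω ≤ B := hB ⟨z, h, rfl⟩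
    exact (h1.trans (le_max_right 1 B)).trans (le_add_of_nonneg_right (Nat.cast_nonneg _))

/-- A converse to `1 - u ≤ exp (-u)` whose loss is uniform in `u ≤ v` and disappears as `v → 0`. -/
lemma exp_neg_div_one_sub_le {u v : ℝ} (hu : 0 ≤ u) (huv : u ≤ v) (hv : v < 1) :
    Real.exp (-(u / (1 - v))) ≤ 1 - u := by
  have h1 : 0 < 1 - u := by linarith
  have h2 : 0 < 1 - v := by linarith
  rw [← Real.le_log_iff_exp_le h1]
  refine le_trans ?_ (Real.one_sub_inv_le_log_of_pos h1)
  have h3 : 1 - (1 - u)⁻¹ = -(u / (1 - u)) := by field_simp; ring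
  rw [h3]
  gcongr

variable {ι : Type*} {l : Filter ι} [l.IsCountablyGenerated] {y q : ℝ} {a r κ : ι → ℝ}

/-- Each factor of the product is `1 - u` with `u` at most the tail at the apex, `(a y)^{-α} → 0`.
The lower bound on finite balls does not depend on the radius, so it passes to all of `ℤ^d` by
continuity from above. -/
lemma exists_tendsto_le_measureReal_forall [IsProbabilityMeasure P] (hd : 1 ≤ d) (hα : d < α)
    (hmeas : ∀ z, Measurable (ξ z)) (hindep : iIndepFun ξ P)
    (hdist : ∀ z, ∀ x : ℝ, 1 ≤ x → P.real {ω | ξ z ω ≤ x} = 1 - x ^ (-α))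
    (hy : 0 < y) (hq : 0 < q) (ha : Tendsto a l atTop) (hr : Tendsto r l atTop)
    (har : ∀ᶠ t in l, a t ^ (-α) = (r t ^ d)⁻¹) :
    ∃ S : ι → ℝ,
      Tendsto S l (𝓝 (Real.exp (-(frechetConst d α * (d / (α - d) / q) ^ d * y ^ (d - α))))) ∧
      ∀ᶠ t in l, S t ≤ P.real {ω | ∀ z, ξ z ω ≤ a t * (y + q * (l1Norm z / r t))} := by
  have hα0 : 0 < α := (Nat.cast_nonneg d).trans_lt hα
  obtain ⟨S, hS, hle⟩ := exists_tendsto_sum_rpow_le hd hα hy hq hr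
  have hay : Tendsto (fun t => a t * y) l atTop := ha.atTop_mul_const hy
  have hv : Tendsto (fun t => (a t * y) ^ (-α)) l (𝓝 0) := (tendsto_rpow_neg_atTop hα0).comp hay
  refine ⟨fun t => Real.exp (-(S t / (1 - (a t * y) ^ (-α)))), ?_, ?_⟩
  · have h := (hS.div (hv.const_sub 1) (by norm_num)).neg.rexp
    simpa using h
  · filter_upwards [hle, har, hay.eventually_ge_atTop 1, hv.eventually_lt_const one_pos,
      hr.eventually_gt_atTop 0, ha.eventually_gt_atTop 0] with t hle har hay hv hr ha
    have hb : ∀ z : Fin d → ℤ, a t * y ≤ a t * (y + q * (l1Norm z / r t)) := fun z => by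
      gcongr
      exact le_add_of_nonneg_right (by positivity)
    have hfin : ∀ n, Real.exp (-(S t / (1 - (a t * y) ^ (-α)))) ≤
        P.real {ω | ∀ z ∈ l1Ball d n, ξ z ω ≤ a t * (y + q * (l1Norm z / r t))} := by
      intro n
      rw [measureReal_forall_mem_le hindep hdist _ fun z => hay.trans (hb z)]
      have h1v : 0 < 1 - (a t * y) ^ (-α) := by linarith
      calc Real.exp (-(S t / (1 - (a t * y) ^ (-α))))
          ≤ Real.exp (-((∑ z ∈ l1Ball d n, (y + q * (l1Norm z / r t)) ^ (-α)) / r t ^ d /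
              (1 - (a t * y) ^ (-α)))) := by
            gcongr
            exact hle _
        _ = ∏ z ∈ l1Ball d n, Real.exp (-((a t * (y + q * (l1Norm z / r t))) ^ (-α) /
              (1 - (a t * y) ^ (-α)))) := by
            rw [← Real.exp_sum, Finset.sum_neg_distrib, ← Finset.sum_div, div_eq_inv_mul _ (r t ^ d),
              Finset.mul_sum]
            congr 3
            refine Finset.sum_congr rfl fun z _ => ?_
            rw [Real.mul_rpow ha.le (by positivity), har]
        _ ≤ _ := by
            refine Finset.prod_le_prod (fun _ _ => (Real.exp_pos _).le) fun z _ => ?_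
            refine exp_neg_div_one_sub_le (by positivity) ?_ hv
            exact Real.rpow_le_rpow_of_nonpos (by linarith) (hb z) (by linarith)
    have hset : {ω | ∀ z, ξ z ω ≤ a t * (y + q * (l1Norm z / r t))} =
        ⋂ n, {ω | ∀ z ∈ l1Ball d n, ξ z ω ≤ a t * (y + q * (l1Norm z / r t))} := by
      ext ω
      simp only [mem_ofPred_eq, mem_iInter]
      exact ⟨fun h n z _ => h z, fun h z => h (l1Norm z) z (mem_l1Ball.2 le_rfl)⟩
    have hlim := tendsto_measure_iInter_atTop (μ := P)
      (s := fun n => {ω | ∀ z ∈ l1Ball d n, ξ z ω ≤ a t * (y + q * (l1Norm z / r t))})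
      (fun n => by
        refine MeasurableSet.nullMeasurableSet ?_
        simp only [ofPred_forall]
        exact Finset.measurableSet_biInter _ fun z _ => measurableSet_le (hmeas z) measurable_const)
      (fun m n hmn ω h z hz => h z (mem_l1Ball.2 ((mem_l1Ball.1 hz).trans hmn)))
      ⟨0, measure_ne_top _ _⟩
    rw [← hset] at hlim
    exact ge_of_tendsto' ((ENNReal.tendsto_toReal (measure_ne_top _ _)).comp hlim) hfin

/-- Only sites in a ball are constrained, since a small `L_t` gives no useful bound far away; as `κ
→ ∞` the limit is unaffected. -/
lemma exists_tendsto_measureReal_forall_le (hd : 1 ≤ d) (hα : d < α)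
    (hindep : iIndepFun ξ P)
    (hdist : ∀ z, ∀ x : ℝ, 1 ≤ x → P.real {ω | ξ z ω ≤ x} = 1 - x ^ (-α))
    (hy : 0 < y) (hq : 0 < q) (ha : Tendsto a l atTop) (hr : Tendsto r l atTop)
    (hκ : Tendsto κ l atTop) (har : ∀ᶠ t in l, a t ^ (-α) = (r t ^ d)⁻¹) :
    ∃ S : ι → ℝ,
      Tendsto S l (𝓝 (Real.exp (-(frechetConst d α * (d / (α - d) / q) ^ d * y ^ (d - α))))) ∧
      ∀ᶠ t in l, P.real {ω | ∀ z ∈ l1Ball d ⌊κ t * r t⌋₊,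
        ξ z ω ≤ a t * (y + q * (l1Norm z / r t))} ≤ S t := by
  have hα0 : 0 < α := (Nat.cast_nonneg d).trans_lt hα
  obtain ⟨S, hS, hle⟩ := exists_tendsto_le_sum_rpow hd hα hy hq hr hκ
  refine ⟨fun t => Real.exp (-S t), hS.neg.rexp, ?_⟩
  filter_upwards [hle, har, (ha.atTop_mul_const hy).eventually_ge_atTop 1,
    hr.eventually_gt_atTop 0, ha.eventually_gt_atTop 0] with t hle har hay hr ha
  have hb : ∀ z : Fin d → ℤ, 1 ≤ a t * (y + q * (l1Norm z / r t)) := fun z => by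
    refine hay.trans ?_
    gcongr
    exact le_add_of_nonneg_right (by positivity)
  rw [measureReal_forall_mem_le hindep hdist _ hb]
  calc ∏ z ∈ l1Ball d ⌊κ t * r t⌋₊, (1 - (a t * (y + q * (l1Norm z / r t))) ^ (-α))
      ≤ ∏ z ∈ l1Ball d ⌊κ t * r t⌋₊, Real.exp (-(a t * (y + q * (l1Norm z / r t))) ^ (-α)) := by
        refine Finset.prod_le_prod (fun z _ => ?_) fun z _ => Real.one_sub_le_exp_neg _
        exact sub_nonneg.2 (Real.rpow_le_one_of_one_le_of_nonpos (hb z) (by linarith))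
    _ = Real.exp (-((∑ z ∈ l1Ball d ⌊κ t * r t⌋₊, (y + q * (l1Norm z / r t)) ^ (-α)) /
          r t ^ d)) := by
        rw [← Real.exp_sum, Finset.sum_neg_distrib, div_eq_inv_mul, Finset.mul_sum]
        congr 2
        refine Finset.sum_congr rfl fun z _ => ?_
        rw [Real.mul_rpow ha.le (by positivity), har]
    _ ≤ Real.exp (-S t) := by gcongr

end Pareto

/-! ### Scales, and total mass versus cones -/

lemma tendsto_div_log_atTop : Tendsto (fun t => t / Real.log t) atTop atTop := by
  have h := Real.isLittleO_log_id_atTop.tendsto_div_nhds_zero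
  have h1 : Tendsto (fun t => Real.log t / t) atTop (𝓝[>] 0) := by
    refine tendsto_nhdsWithin_iff.2 ⟨h, ?_⟩
    filter_upwards [eventually_gt_atTop 1] with t ht
    exact div_pos (Real.log_pos ht) (by linarith)
  refine h1.inv_tendsto_nhdsGT_zero.congr fun t => ?_
  simp

/-- The order of magnitude of `L_t`. -/
noncomputable def massScale (d : ℕ) (α t : ℝ) : ℝ := (t / Real.log t) ^ ((d : ℝ) / (α - d))

/-- The distance from the origin at which the mass concentrates. -/
noncomputable def spaceScale (d : ℕ) (α t : ℝ) : ℝ := (t / Real.log t) ^ (α / (α - d))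

section Scales

variable {d : ℕ} {α : ℝ}

lemma tendsto_massScale (hd : 1 ≤ d) (hα : d < α) : Tendsto (massScale d α) atTop atTop :=
  (tendsto_rpow_atTop (div_pos (by exact_mod_cast hd) (sub_pos.2 hα))).comp tendsto_div_log_atTop

lemma tendsto_spaceScale (hα : d < α) : Tendsto (spaceScale d α) atTop atTop :=
  (tendsto_rpow_atTop (div_pos ((Nat.cast_nonneg d).trans_lt hα) (sub_pos.2 hα))).comp
    tendsto_div_log_atTop

/-- The balance between `r^d` sites and the tail probability `a^{-α}`: about one site at distance of
order `r` has potential of order `a`. -/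
lemma massScale_rpow (hα : d < α) {t : ℝ} (ht : 1 < t) :
    massScale d α t ^ (-α) = (spaceScale d α t ^ d)⁻¹ := by
  have h0 : 0 ≤ t / Real.log t := (div_pos (by linarith) (Real.log_pos ht)).le
  have hαd : α - d ≠ 0 := (sub_pos.2 hα).ne'
  rw [massScale, spaceScale, ← Real.rpow_mul h0, ← Real.rpow_natCast, ← Real.rpow_mul h0,
    ← Real.rpow_neg h0]
  congr 1
  field_simp

/-- Thus a cone of slope `q a / r` acting over time `t` produces the power `t^q`, comparable to `a`
(up to logarithms) exactly at `q = d/(α - d)`. -/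
lemma massScale_mul_div_spaceScale (hα : d < α) {t : ℝ} (ht : 1 < t) :
    massScale d α t / spaceScale d α t * t = Real.log t := by
  have ht0 : 0 < t := by linarith
  have h0 : 0 < t / Real.log t := div_pos ht0 (Real.log_pos ht)
  have hαd : α - d ≠ 0 := (sub_pos.2 hα).ne'
  rw [massScale, spaceScale, ← Real.rpow_sub h0,
    show (d : ℝ) / (α - d) - α / (α - d) = -1 by field_simp; ring, Real.rpow_neg_one, inv_div]
  field_simp

lemma tendsto_rpow_div_massScale {q : ℝ} (hq : q < d / (α - d)) :
    Tendsto (fun t => t ^ q / massScale d α t) atTop (𝓝 0) := by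
  have h := (isLittleO_log_rpow_rpow_atTop ((d : ℝ) / (α - d))
    (sub_pos.2 hq)).tendsto_div_nhds_zero
  refine h.congr' ?_
  filter_upwards [eventually_gt_atTop 1] with t ht
  have ht0 : 0 < t := by linarith
  have hl := Real.log_pos ht
  rw [massScale, Real.div_rpow ht0.le hl.le, Real.rpow_sub ht0]
  field_simp

/-- Upper bound for `L_t` on the event that the potential is below a cone. -/
lemma eventually_logMass_div_le (hd : 1 ≤ d) (hα : d < α) {y y' q : ℝ} (hyy' : y < y')
    (hq0 : 0 < q) (hq : q < d / (α - d)) :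
    ∀ᶠ t in atTop, ∀ ζ : (Fin d → ℤ) → ℝ, (∀ z, 0 ≤ ζ z) → (∃ A, ∀ z, ζ z ≤ A + l1Norm z) →
      (∀ z, ζ z ≤ massScale d α t * (y + q * (l1Norm z / spaceScale d α t))) →
      logMass (minimalSolution ζ) t / massScale d α t ≤ y' := by
  have hlim : Tendsto (fun t => 2 * d * (t ^ q / massScale d α t)) atTop (𝓝 0) := by
    simpa using (tendsto_rpow_div_massScale hq).const_mul (2 * (d : ℝ))
  filter_upwards [hlim.eventually_le_const (sub_pos.2 hyy'), eventually_gt_atTop 1,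
    (tendsto_massScale hd hα).eventually_gt_atTop 0,
    (tendsto_spaceScale hα).eventually_gt_atTop 0] with t hlim ht ha hr ζ hζ0 ⟨A, hA⟩ hζ
  have ht0 : 0 < t := by linarith
  set a := massScale d α t
  set r := spaceScale d α t
  have hcone : ∀ z, ζ z ≤ a * y + a * q / r * l1Norm z := fun z =>
    (hζ z).trans_eq (by field_simp)
  have hU := totalMass_minimalSolution_le (c := a * q / r) (by positivity) hcone ht0.le
  have hpos : 0 < totalMass (minimalSolution ζ) t := by
    refine lt_of_lt_of_le ?_ (le_totalMass_minimalSolution hζ0 hA ht0.le le_rfl 0)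
    positivity
  have hexp : Real.exp (a * q / r * t) = t ^ q := by
    rw [Real.rpow_def_of_pos ht0, ← massScale_mul_div_spaceScale hα ht]
    congr 1
    ring
  have hlog := Real.log_le_log hpos hU
  rw [Real.log_exp, hexp] at hlog
  have h1 : logMass (minimalSolution ζ) t ≤ a * y - 2 * d + 2 * d * t ^ q := by
    rw [logMass, div_mul_eq_mul_div, one_mul, div_le_iff₀ ht0]
    linarith
  have h2 : 2 * d * t ^ q ≤ (y' - y) * a := by
    rwa [← mul_div_assoc, div_le_iff₀ ha] at hlim
  rw [div_le_iff₀ ha]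
  have hd0 : (0 : ℝ) ≤ d := d.cast_nonneg
  linarith

lemma le_log_pow_div_factorial (n : ℕ) {s : ℝ} (hs : 0 < s) :
    -(n * Real.log (n / s)) ≤ Real.log (s ^ n / n.factorial) := by
  rcases Nat.eq_zero_or_pos n with rfl | hn
  · simp
  have hn0 : (0 : ℝ) < n := by exact_mod_cast hn
  have h1 : Real.log n.factorial ≤ n * Real.log n := by
    rw [← Real.log_pow]
    refine Real.log_le_log (by positivity) ?_
    exact_mod_cast Nat.factorial_le_pow n
  rw [Real.log_div hn0.ne' hs.ne', Real.log_div (by positivity) (by positivity), Real.log_pow]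
  linarith

/-- If `L_t` is small, then the potential is below a cone, within a large box. -/
lemma eventually_le_of_logMass_div_le (hd : 1 ≤ d) (hα : d < α) {y y' q : ℝ}
    (hyy' : y < y') (hq : d / (α - d) < q) :
    ∃ η : ℝ, 0 < η ∧ ∀ᶠ t : ℝ in atTop, ∀ ζ : (Fin d → ℤ) → ℝ, (∀ z, 0 ≤ ζ z) →
      (∃ A, ∀ z, ζ z ≤ A + l1Norm z) → logMass (minimalSolution ζ) t / massScale d α t ≤ y →
      ∀ z ∈ l1Ball d ⌊t ^ η * spaceScale d α t⌋₊,
        ζ z ≤ massScale d α t * (y' + q * (l1Norm z / spaceScale d α t)) := by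
  have hq₀ : 0 < (d : ℝ) / (α - d) := div_pos (by exact_mod_cast hd) (sub_pos.2 hα)
  -- The fraction `ρ` of the time is spent walking; it is small enough that both strict inequalities
  -- survive the loss of this time.
  obtain ⟨ρ, hρ0, hρ1, hρy, hρq⟩ : ∃ ρ : ℝ, 0 < ρ ∧ ρ < 1 ∧ y < (1 - ρ) * y' ∧
      d / (α - d) < (1 - ρ) * q := by
    have hc : ∀ c : ℝ, Tendsto (fun ρ : ℝ => (1 - ρ) * c) (𝓝[>] 0) (𝓝 c) := fun c => by
      have : Tendsto (fun ρ : ℝ => (1 - ρ) * c) (𝓝 0) (𝓝 ((1 - 0) * c)) :=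
        Continuous.tendsto (by fun_prop) 0
      rw [sub_zero, one_mul] at this
      exact this.mono_left nhdsWithin_le_nhds
    have h01 : ∀ᶠ ρ in 𝓝[>] (0 : ℝ), ρ ∈ Ioo (0 : ℝ) 1 := Ioo_mem_nhdsGT one_pos
    obtain ⟨ρ, h1, h2, h3⟩ := (h01.and
      (((hc y').eventually_const_lt hyy').and ((hc q).eventually_const_lt hq))).exists
    exact ⟨ρ, h1.1, h1.2, h2, h3⟩
  set q₁ := (1 - ρ) * q
  refine ⟨(q₁ - d / (α - d)) / 2, half_pos (sub_pos.2 hρq), ?_⟩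
  -- Half of the spare exponent enlarges the box; the other half absorbs the constant `ρ⁻¹`.
  set η := (q₁ - d / (α - d)) / 2
  have hη : 0 < η := half_pos (sub_pos.2 hρq)
  have hlog : ∀ᶠ t : ℝ in atTop, 1 ≤ Real.log t := Real.tendsto_log_atTop.eventually_ge_atTop 1
  filter_upwards [eventually_gt_atTop 1, hlog, (tendsto_massScale hd hα).eventually_gt_atTop 0,
    (tendsto_spaceScale hα).eventually_gt_atTop 0,
    ((tendsto_massScale hd hα).atTop_mul_const (sub_pos.2 hρy)).eventually_ge_atTop (2 * d),
    (tendsto_rpow_atTop hη).eventually_ge_atTop ρ⁻¹]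
    with t ht hlog ha hr had hρt ζ hζ0 ⟨A, hA⟩ hL z hz
  have ht0 : 0 < t := by linarith
  have hscale := massScale_mul_div_spaceScale hα ht
  have hrle : spaceScale d α t ≤ t ^ (d / (α - d) + 1) := by
    have hαd : α - d ≠ 0 := (sub_pos.2 hα).ne'
    rw [spaceScale, show α / (α - d) = d / (α - d) + 1 by field_simp; ring]
    exact Real.rpow_le_rpow (div_pos ht0 (by linarith)).le (div_le_self ht0.le hlog) (by linarith)
  set a := massScale d α t
  set r := spaceScale d α t
  set n := l1Norm z
  have hn : (n : ℝ) ≤ t ^ η * r :=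
    (Nat.cast_le.2 (mem_l1Ball.1 hz)).trans (Nat.floor_le (by positivity))
  have hs : 0 < ρ * t := mul_pos hρ0 ht0
  -- Inside the box `n / (ρ t) ≤ t^{q₁}`, so the travel cost is at most linear in the distance, with
  -- slope `q₁ log t`.
  have hnlog : n * Real.log (n / (ρ * t)) ≤ n * (q₁ * Real.log t) := by
    rcases Nat.eq_zero_or_pos n with h0 | h0
    · simp [h0]
    have hn0 : (0 : ℝ) < n := by exact_mod_cast h0
    refine mul_le_mul_of_nonneg_left ?_ hn0.le
    rw [← Real.log_rpow ht0]
    refine Real.log_le_log (by positivity) ?_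
    rw [div_le_iff₀ hs]
    calc (n : ℝ) ≤ t ^ η * t ^ (d / (α - d) + 1) := hn.trans (by gcongr)
      _ = (t ^ η * t ^ (d / (α - d) + 1)) * (ρ⁻¹ * ρ) := by rw [inv_mul_cancel₀ hρ0.ne', mul_one]
      _ ≤ (t ^ η * t ^ (d / (α - d) + 1)) * (t ^ η * ρ) := by gcongr
      _ = t ^ (η + (d / (α - d) + 1) + η) * ρ := by
          rw [Real.rpow_add ht0 (η + _), Real.rpow_add ht0 η]
          ring
      _ = t ^ q₁ * (ρ * t) := by
          rw [show η + (d / (α - d) + 1) + η = q₁ + 1 by simp only [η]; ring,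
            Real.rpow_add_one ht0.ne']
          ring
  have hlow := le_totalMass_minimalSolution hζ0 hA hs.le
    (mul_le_of_le_one_left ht0.le hρ1.le) z
  have hlow' := Real.log_le_log (by positivity) hlow
  rw [Real.log_mul (Real.exp_pos _).ne' (by positivity), Real.log_exp] at hlow'
  have h1 := le_log_pow_div_factorial n hs
  have h2 : Real.log (totalMass (minimalSolution ζ) t) ≤ y * a * t := by
    rwa [div_le_iff₀ ha, logMass, div_mul_eq_mul_div, one_mul, div_le_iff₀ ht0] at hL
  have h3 : ζ z * (1 - ρ) * t ≤ a * ((1 - ρ) * y') * t + n * (q₁ * Real.log t) := by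
    have h4 : 2 * d * t ≤ a * ((1 - ρ) * y' - y) * t := mul_le_mul_of_nonneg_right had ht0.le
    linarith
  have h5 : (n : ℝ) * (q₁ * Real.log t) = (1 - ρ) * (a * (q * (n / r))) * t := by
    rw [← hscale]
    simp only [q₁]
    field_simp
  have h6 : (ζ z) * ((1 - ρ) * t) ≤ a * (y' + q * (n / r)) * ((1 - ρ) * t) := by
    rw [h5] at h3
    linarith
  exact le_of_mul_le_mul_right h6 (mul_pos (by linarith) ht0)

end Scales

/-! ### Convergence in law -/

/-- Pointwise convergence of the distribution functions implies weak convergence. -/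
lemma tendsto_of_forall_tendsto_measureReal_Iic {ι : Type*} {l : Filter ι} [l.IsCountablyGenerated]
    {μ : ι → ProbabilityMeasure ℝ} {ν : ProbabilityMeasure ℝ}
    (h : ∀ y, Tendsto (fun i => (μ i : Measure ℝ).real (Iic y)) l
      (𝓝 ((ν : Measure ℝ).real (Iic y)))) : Tendsto μ l (𝓝 ν) := by
  refine (isPiSystem_Ioc (id : ℝ → ℝ) id).tendsto_probabilityMeasure_of_tendsto_of_mem ?_ ?_ ?_
  · rintro s ⟨a, b, -, rfl⟩
    exact measurableSet_Ioc
  · intro u hu x hx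
    obtain ⟨ε, hε, hεu⟩ := Metric.isOpen_iff.1 hu x hx
    refine ⟨Ioc (x - ε / 2) (x + ε / 2), ⟨x - ε / 2, x + ε / 2, by simp only [id]; linarith, rfl⟩,
      Ioc_mem_nhds (by linarith) (by linarith), fun w hw => hεu ?_⟩
    rw [Real.ball_eq_Ioo]
    exact ⟨by linarith [hw.1], by linarith [hw.2]⟩
  · rintro s ⟨a, b, hab, rfl⟩
    have hab' : a ≤ b := le_of_lt hab
    have hsub : ∀ m : ProbabilityMeasure ℝ, (m : Measure ℝ).real (Ioc a b) =
        (m : Measure ℝ).real (Iic b) - (m : Measure ℝ).real (Iic a) := fun m => by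
      rw [← Iic_sdiff_Iic, measureReal_sdiff (Iic_subset_Iic.2 hab') measurableSet_Iic]
    rw [← NNReal.tendsto_coe]
    have h2 := (h b).sub (h a)
    simp only [← hsub] at h2
    exact h2

/-- The law is that of `(θ / X)^{1/γ}` with `X` standard exponential. -/
lemma exists_frechet {θ γ : ℝ} (hθ : 0 < θ) (hγ : 0 < γ) :
    ∃ ν : ProbabilityMeasure ℝ, ∀ y : ℝ, (ν : Measure ℝ).real (Iic y) =
      if 0 < y then Real.exp (-(θ * y ^ (-γ))) else 0 := by
  have hprob := isProbabilityMeasure_expMeasure one_pos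
  have hf : Measurable fun x : ℝ => (θ / x) ^ γ⁻¹ := by fun_prop
  refine ⟨⟨(expMeasure 1).map fun x => (θ / x) ^ γ⁻¹,
    Measure.isProbabilityMeasure_map hf.aemeasurable⟩, fun y => ?_⟩
  have hcdf : ∀ x, (expMeasure 1).real (Iic x) = if 0 ≤ x then 1 - Real.exp (-x) else 0 := fun x => by
    rw [← cdf_eq_real, cdf_expMeasure_eq one_pos, one_mul]
  have hpos : ∀ᵐ x ∂(expMeasure 1), 0 < x := by
    have h := hcdf 0
    rw [if_pos le_rfl, neg_zero, Real.exp_zero, sub_self, measureReal_eq_zero_iff] at h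
    rw [ae_iff]
    simp only [not_lt]
    exact h
  change ((expMeasure 1).map fun x => (θ / x) ^ γ⁻¹).real (Iic y) = _
  rw [map_measureReal_apply hf measurableSet_Iic]
  split_ifs with hy
  · have hset : (fun x : ℝ => (θ / x) ^ γ⁻¹) ⁻¹' Iic y =ᵐ[expMeasure 1] Ici (θ * y ^ (-γ)) := by
      filter_upwards [hpos] with x hx
      refine propext ?_
      change (θ / x) ^ γ⁻¹ ≤ y ↔ θ * y ^ (-γ) ≤ x
      rw [Real.rpow_inv_le_iff_of_pos (by positivity) hy.le hγ, div_le_iff₀ hx, Real.rpow_neg hy.le,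
        ← div_eq_mul_inv, div_le_iff₀ (by positivity), mul_comm]
    have hatoms : (Iic (θ * y ^ (-γ)) : Set ℝ) =ᵐ[expMeasure 1] Iio (θ * y ^ (-γ)) := by
      have hac : expMeasure 1 ≪ volume := withDensity_absolutelyContinuous _ _
      exact hac.ae_eq Iio_ae_eq_Iic.symm
    rw [measureReal_congr hset, ← compl_Iio, probReal_compl_eq_one_sub measurableSet_Iio,
      ← measureReal_congr hatoms, hcdf, if_pos (by positivity)]
    ring
  · rw [measureReal_eq_zero_iff]
    refine measure_mono_null (fun x hx => ?_) (ae_iff.1 hpos)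
    intro hx0
    have h1 : (θ / x) ^ γ⁻¹ ≤ y := hx
    have h2 : 0 < (θ / x) ^ γ⁻¹ := by positivity
    linarith

section Law

variable {Ω : Type*} [MeasurableSpace Ω] {P : Measure Ω} {d : ℕ} {α : ℝ}
  {ξ : (Fin d → ℤ) → Ω → ℝ}

/-- Sums in `ENNReal` are measurable without any summability; they agree with the real sums where
the potential grows at most linearly. -/
lemma aemeasurable_totalMass_minimalSolution (hmeas : ∀ z, Measurable (ξ z))
    (hgrow : ∀ᵐ ω ∂P, ∃ A, ∀ z, ξ z ω ≤ A + l1Norm z) {t : ℝ} (ht : 0 ≤ t) :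
    AEMeasurable (fun ω => totalMass (minimalSolution fun z => ξ z ω) t) P := by
  refine ⟨fun ω => (∑' z, ∑' k, ENNReal.ofReal (jumpTerm (fun z => ξ z ω) k t z)).toReal, ?_, ?_⟩
  · refine Measurable.ennreal_toReal (Measurable.tsum fun z =>
      Measurable.tsum fun k => Measurable.ennreal_ofReal ?_)
    exact (continuous_jumpTerm k z).measurable.comp
      ((measurable_pi_lambda _ hmeas).prodMk measurable_const)
  · filter_upwards [hgrow] with ω ⟨A, hA⟩
    have hA' : ∀ z, ξ z ω ≤ A + 1 * l1Norm z := by simpa using hA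
    have hnn : ∀ z, 0 ≤ minimalSolution (fun z => ξ z ω) t z :=
      (isNonnegSolution_minimalSolution zero_le_one hA').nonneg t ht
    have h1 : ∀ z, ∑' k, ENNReal.ofReal (jumpTerm (fun z => ξ z ω) k t z) =
        ENNReal.ofReal (minimalSolution (fun z => ξ z ω) t z) := fun z =>
      (ENNReal.ofReal_tsum_of_nonneg (fun k => jumpTerm_nonneg _ k ht z)
        (summable_jumpTerm zero_le_one hA' ht z)).symm
    simp_rw [h1]
    rw [← ENNReal.ofReal_tsum_of_nonneg hnn (summable_minimalSolution zero_le_one hA' ht),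
      ENNReal.toReal_ofReal (tsum_nonneg hnn), totalMass]

variable [IsProbabilityMeasure P]

/-- Height and slope are both scaled by `x`: cones with `x < 1` give the lower bound and cones with
`x > 1` the upper bound. Continuity at `x = 1` closes the gap. -/
lemma tendsto_measureReal_logMass_le_of_pos (hd : 1 ≤ d) (hα : d < α)
    (hmeas : ∀ z, Measurable (ξ z)) (hindep : iIndepFun ξ P)
    (hdist : ∀ z, ∀ x : ℝ, 1 ≤ x → P.real {ω | ξ z ω ≤ x} = 1 - x ^ (-α)) {y : ℝ} (hy : 0 < y) :
    Tendsto (fun t => P.real {ω | logMass (minimalSolution fun z => ξ z ω) t / massScale d α t ≤ y})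
      atTop (𝓝 (Real.exp (-(frechetConst d α * y ^ (d - α))))) := by
  have hgood : ∀ᵐ ω ∂P, (∀ z, 0 ≤ ξ z ω) ∧ ∃ A, ∀ z, ξ z ω ≤ A + l1Norm z := by
    filter_upwards [ae_one_lt hdist, ae_exists_le_add_l1Norm hα hmeas hdist] with ω h1 h2
    exact ⟨fun z => zero_le_one.trans (h1 z).le, h2⟩
  have hq : 0 < (d : ℝ) / (α - d) := div_pos (by exact_mod_cast hd) (sub_pos.2 hα)
  have har : ∀ᶠ t in atTop, massScale d α t ^ (-α) = (spaceScale d α t ^ d)⁻¹ := by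
    filter_upwards [eventually_gt_atTop 1] with t ht using massScale_rpow hα ht
  set G : ℝ → ℝ := fun x => Real.exp (-(frechetConst d α *
    (d / (α - d) / (d / (α - d) * x)) ^ d * (y * x) ^ (d - α)))
  have hG1 : G 1 = Real.exp (-(frechetConst d α * y ^ (d - α))) := by
    simp [G, div_self hq.ne']
  have hG : Tendsto G (𝓝 1) (𝓝 (G 1)) := by
    have h1 : ContinuousAt (fun x : ℝ => (y * x) ^ (d - α)) 1 :=
      ContinuousAt.rpow_const (by fun_prop) (Or.inl (by simpa using hy.ne'))
    have h2 : ContinuousAt (fun x : ℝ => (d / (α - d) / (d / (α - d) * x)) ^ d) 1 :=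
      (ContinuousAt.div continuousAt_const (by fun_prop) (by simpa using hq.ne')).pow d
    exact Real.continuous_exp.continuousAt.comp ((continuousAt_const.mul h2).mul h1).neg
  rw [← hG1]
  refine tendsto_order.2 ⟨fun c hc => ?_, fun c hc => ?_⟩
  · have h01 : ∀ᶠ x in 𝓝[<] (1 : ℝ), x ∈ Ioo (0 : ℝ) 1 := Ioo_mem_nhdsLT one_pos
    obtain ⟨x, hx, hGx⟩ :=
      (h01.and ((hG.mono_left nhdsWithin_le_nhds).eventually_const_lt hc)).exists
    obtain ⟨S, hS, hle⟩ := exists_tendsto_le_measureReal_forall hd hα hmeas hindep hdist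
      (mul_pos hy hx.1) (mul_pos hq hx.1) (tendsto_massScale hd hα) (tendsto_spaceScale hα) har
    filter_upwards [hS.eventually_const_lt hGx, hle, eventually_logMass_div_le hd hα
      (mul_lt_of_lt_one_right hy hx.2) (mul_pos hq hx.1) (mul_lt_of_lt_one_right hq hx.2)]
      with t hS hle hmass
    refine hS.trans_le (hle.trans (ENNReal.toReal_mono (measure_ne_top _ _) (measure_mono_ae ?_)))
    filter_upwards [hgood] with ω hω hcone
    exact hmass _ hω.1 hω.2 hcone
  · have h01 : ∀ᶠ x in 𝓝[>] (1 : ℝ), x ∈ Ioi (1 : ℝ) := self_mem_nhdsWithin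
    obtain ⟨x, hx, hGx⟩ :=
      (h01.and ((hG.mono_left nhdsWithin_le_nhds).eventually_lt_const hc)).exists
    have hx1 : 1 < x := hx
    have hx0 : 0 < x := by linarith
    obtain ⟨η, hη, hmass⟩ := eventually_le_of_logMass_div_le hd hα
      (lt_mul_of_one_lt_right hy hx1) (lt_mul_of_one_lt_right hq hx1)
    obtain ⟨S, hS, hle⟩ := exists_tendsto_measureReal_forall_le hd hα hindep hdist
      (mul_pos hy hx0) (mul_pos hq hx0) (tendsto_massScale hd hα) (tendsto_spaceScale hα)
      (tendsto_rpow_atTop hη) har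
    filter_upwards [hS.eventually_lt_const hGx, hle, hmass] with t hS hle hmass
    refine lt_of_le_of_lt ((ENNReal.toReal_mono (measure_ne_top _ _) (measure_mono_ae ?_)).trans
      hle) hS
    filter_upwards [hgood] with ω hω hL
    exact hmass _ hω.1 hω.2 hL

lemma frechetConst_pos (hd : 1 ≤ d) (hα : d < α) : 0 < frechetConst d α := by
  have hd0 : (0 : ℝ) < d := by exact_mod_cast hd
  have hαd := sub_pos.2 hα
  have := Real.Gamma_pos_of_pos hαd
  have := Real.Gamma_pos_of_pos (hd0.trans hα)
  rw [frechetConst_eq hd]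
  positivity

/-- For `y ≤ 0` monotonicity suffices, because the Fréchet distribution function tends to zero at
`0+`. -/
lemma tendsto_measureReal_logMass_le (hd : 1 ≤ d) (hα : d < α)
    (hmeas : ∀ z, Measurable (ξ z)) (hindep : iIndepFun ξ P)
    (hdist : ∀ z, ∀ x : ℝ, 1 ≤ x → P.real {ω | ξ z ω ≤ x} = 1 - x ^ (-α)) (y : ℝ) :
    Tendsto (fun t => P.real {ω | logMass (minimalSolution fun z => ξ z ω) t / massScale d α t ≤ y})
      atTop (𝓝 (if 0 < y then Real.exp (-(frechetConst d α * y ^ (d - α))) else 0)) := by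
  split_ifs with hy
  · exact tendsto_measureReal_logMass_le_of_pos hd hα hmeas hindep hdist hy
  refine tendsto_order.2 ⟨fun c hc => Eventually.of_forall fun t =>
    hc.trans_le measureReal_nonneg, fun c hc => ?_⟩
  have hlim : Tendsto (fun x : ℝ => Real.exp (-(frechetConst d α * x ^ (d - α)))) (𝓝[>] 0)
      (𝓝 0) := by
    refine Real.tendsto_exp_neg_atTop_nhds_zero.comp ?_
    exact (tendsto_rpow_neg_nhdsGT_zero (sub_neg.2 hα)).const_mul_atTop (frechetConst_pos hd hα)
  have hpos : ∀ᶠ x in 𝓝[>] (0 : ℝ), x ∈ Ioi (0 : ℝ) := self_mem_nhdsWithin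
  obtain ⟨x, hx, hxc⟩ := (hpos.and (hlim.eventually_lt_const hc)).exists
  filter_upwards [(tendsto_measureReal_logMass_le_of_pos hd hα hmeas hindep hdist
    hx).eventually_lt_const hxc] with t ht
  refine lt_of_le_of_lt (measureReal_mono fun ω hω => ?_) ht
  exact le_trans hω (le_trans (not_lt.1 hy) (le_of_lt hx))

end Law

end ParabolicAnderson

theorem theorem1p2 {Ω : Type*} [MeasurableSpace Ω] (P : Measure Ω) [IsProbabilityMeasure P]
    (d : ℕ) (hd : 1 ≤ d) (α : ℝ) (hα : (d : ℝ) < α)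
    (ξ : (Fin d → ℤ) → Ω → ℝ) (hmeas : ∀ z, Measurable (ξ z)) (hindep : iIndepFun ξ P)
    (hdist : ∀ z, ∀ x : ℝ, 1 ≤ x → P.real {ω | ξ z ω ≤ x} = 1 - x ^ (-α)) :
    -- almost surely there is exactly one nonnegative solution, and its total mass is finite
    (∀ᵐ ω ∂P,
      (∃ u, ParabolicAnderson.IsNonnegSolution (fun z => ξ z ω) u) ∧
      (∀ u v, ParabolicAnderson.IsNonnegSolution (fun z => ξ z ω) u →
        ParabolicAnderson.IsNonnegSolution (fun z => ξ z ω) v → ∀ t, 0 ≤ t → u t = v t) ∧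
      (∀ u, ParabolicAnderson.IsNonnegSolution (fun z => ξ z ω) u →
        ∀ t, 0 ≤ t → Summable (u t))) ∧
    -- the rescaled `L_t` converges in law to the Fréchet distribution `ν`
    (∃ ν : ProbabilityMeasure ℝ,
      (∀ y : ℝ, (ν : Measure ℝ).real (Iic y) =
        if 0 < y then Real.exp (-(ParabolicAnderson.frechetConst d α * y ^ ((d : ℝ) - α)))
        else 0) ∧
      ∀ u : Ω → ℝ → (Fin d → ℤ) → ℝ,
        (∀ᵐ ω ∂P, ParabolicAnderson.IsNonnegSolution (fun z => ξ z ω) (u ω)) →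
        TendstoInDistribution
          (fun (t : ℝ≥0) (ω : Ω) =>
            ParabolicAnderson.logMass (u ω) (t : ℝ)
              * ((t : ℝ) / Real.log (t : ℝ)) ^ (-((d : ℝ) / (α - d))))
          atTop (fun y : ℝ => y) (fun _ => P) (ν : Measure ℝ)) := by
  open ParabolicAnderson in
  have hgrow := ae_exists_le_add_l1Norm hα hmeas hdist
  have hgood : ∀ᵐ ω ∂P, (∀ z, 0 ≤ ξ z ω) ∧ ∃ A, ∀ z, ξ z ω ≤ A + l1Norm z := by
    filter_upwards [ae_one_lt hdist, hgrow] with ω h1 h2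
    exact ⟨fun z => zero_le_one.trans (h1 z).le, h2⟩
  refine ⟨?_, ?_⟩
  · filter_upwards [hgood] with ω ⟨h0, A, hA⟩
    have hA' : ∀ z, ξ z ω ≤ A + 1 * l1Norm z := by simpa using hA
    refine ⟨⟨_, isNonnegSolution_minimalSolution zero_le_one hA'⟩, fun u v hu hv t ht => ?_,
      fun u hu t ht => ?_⟩
    · rw [hu.eq_minimalSolution h0 hA ht, hv.eq_minimalSolution h0 hA ht]
    · rw [hu.eq_minimalSolution h0 hA ht]
      exact summable_minimalSolution zero_le_one hA' ht
  · obtain ⟨ν, hν⟩ := exists_frechet (frechetConst_pos hd hα) (sub_pos.2 hα)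
    rw [neg_sub] at hν
    refine ⟨ν, hν, fun u hu => ?_⟩
    have hmass : ∀ t : ℝ, 0 ≤ t → ∀ᵐ ω ∂P,
        logMass (u ω) t = logMass (minimalSolution fun z => ξ z ω) t := by
      intro t ht
      filter_upwards [hu, hgood] with ω hu ⟨h0, A, hA⟩
      rw [logMass, logMass, totalMass, totalMass, hu.eq_minimalSolution h0 hA ht]
    have haem : ∀ t : ℝ≥0, AEMeasurable (fun ω => logMass (u ω) (t : ℝ)
        * ((t : ℝ) / Real.log (t : ℝ)) ^ (-((d : ℝ) / (α - d)))) P := by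
      intro t
      refine AEMeasurable.mul_const (AEMeasurable.congr ?_ (EventuallyEq.symm (hmass t t.2))) _
      exact ((aemeasurable_totalMass_minimalSolution hmeas hgrow t.2).log).const_mul _
    refine ⟨haem, aemeasurable_id, ?_⟩
    refine tendsto_of_forall_tendsto_measureReal_Iic fun y => ?_
    change Tendsto _ _ (𝓝 ((ν.toMeasure.map fun y : ℝ => y).real (Iic y)))
    rw [Measure.map_id', hν]
    have h := (tendsto_measureReal_logMass_le hd hα hmeas hindep hdist y).comp
      (NNReal.tendsto_coe_atTop.2 tendsto_id)
    refine h.congr' ?_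
    -- For `t > 1` the base `t / log t` is positive, so the negative power is the inverse of the
    -- scale.
    filter_upwards [eventually_gt_atTop 1] with t ht
    have ht1 : (1 : ℝ) < t := by exact_mod_cast ht
    change _ = (P.map _).real (Iic y)
    rw [map_measureReal_apply_of_aemeasurable (haem t) measurableSet_Iic]
    refine measureReal_congr ?_
    filter_upwards [hmass t t.2] with ω hω
    have hscale : ((t : ℝ) / Real.log t) ^ (-((d : ℝ) / (α - d))) = (massScale d α t)⁻¹ :=
      Real.rpow_neg (div_pos (by linarith) (Real.log_pos ht1)).le _
    refine propext ?_
    change _ ↔ logMass (u ω) t * ((t : ℝ) / Real.log t) ^ (-((d : ℝ) / (α - d))) ≤ y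
    rw [hω, hscale, ← div_eq_mul_inv]
    rfl
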